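/- A bivariate copula is a function $C:[0,1]^2\to[0,1]$ with $C(0,x)=C(x,0)=0$ and $C(x,1)=C(1,x)=x$ for all $x\in[0,1]$, and $C(a,c)+C(b,d)-C(a,d)-C(b,c)\ge 0$ for all $0\le a\le b\le 1$, $0\le c\le d\le 1$. A Markov chain generated by $C$ is a Markov process $(X_n)_{n\in\mathbb Z}$ of real random variables on a probability space $(\Omega,\mathcal F,P)$ such that every $X_n$ is uniformly distributed on $[0,1]$ and $P(X_n\le x,\,X_{n+1}\le y)=C(x,y)$ for all $n\in\mathbb Z$ and $x,y\in[0,1]$. The process is $\alpha$-mixing if $$\alpha_n=\sup\{|P(A\cap B)-P(A)P(B)| : A\in\sigma(X_i,\ i\le 0),\ B\in\sigma(X_i,\ i\ge n)\}\longrightarrow 0\quad(n\to\infty).$$ A copula $C$ is said to generate $\alpha$-mixing Markov chains if every Markov chain generated by $C$ is $\alpha$-mixing. **Corollary.** Let $C_1,\dots,C_k$ be copulas, each of which generates $\alpha$-mixing Markov chains, and let $a_1,\dots,a_k\ge 0$ with $\sum_{j=1}^k a_j=1$. Then $C=\sum_{j=1}^k a_jC_j$ is a copula and generates $\alpha$-mixing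 Markov chains. -/

import Mathlib

open MeasureTheory ProbabilityTheory Filter Set
open scoped Topology

universe u v

namespace CopulaChain

/-- A bivariate copula: a function `[0,1]² → [0,1]` that is grounded, has uniform margins and
gives nonnegative mass to every rectangle. It is represented by a function `ℝ → ℝ → ℝ` of which
only the values on the unit square matter. -/
structure IsCopula (C : ℝ → ℝ → ℝ) : Prop where
  mem_unit : ∀ x ∈ Icc (0 : ℝ) 1, ∀ y ∈ Icc (0 : ℝ) 1, C x y ∈ Icc (0 : ℝ) 1
  zero_left : ∀ x ∈ Icc (0 : ℝ) 1, C 0 x = 0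
  zero_right : ∀ x ∈ Icc (0 : ℝ) 1, C x 0 = 0
  one_left : ∀ x ∈ Icc (0 : ℝ) 1, C 1 x = x
  one_right : ∀ x ∈ Icc (0 : ℝ) 1, C x 1 = x
  rect_nonneg : ∀ a b c d : ℝ, 0 ≤ a → a ≤ b → b ≤ 1 → 0 ≤ c → c ≤ d → d ≤ 1 →
    0 ≤ C a c + C b d - C a d - C b c

section Chain

variable {Ω : Type u}

/-- The σ-algebra `σ(X i, i ≤ n)`. -/
abbrev past (X : ℤ → Ω → ℝ) (n : ℤ) : MeasurableSpace Ω :=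
  ⨆ i : ℤ, ⨆ _ : i ≤ n, MeasurableSpace.comap (X i) inferInstance

/-- The σ-algebra `σ(X i, i ≥ n)`. -/
abbrev future (X : ℤ → Ω → ℝ) (n : ℤ) : MeasurableSpace Ω :=
  ⨆ i : ℤ, ⨆ _ : n ≤ i, MeasurableSpace.comap (X i) inferInstance

variable [MeasurableSpace Ω]

/-- The Markov property:
`P(X (n+1) ∈ B | σ(X i, i ≤ n)) = P(X (n+1) ∈ B | σ(X n))` almost surely,
for every time `n` and every Borel set `B`. -/
def HasMarkovProperty (P : Measure Ω) (X : ℤ → Ω → ℝ) : Prop :=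
  ∀ (n : ℤ) (B : Set ℝ), MeasurableSet B →
    P[(X (n + 1) ⁻¹' B).indicator (fun _ => (1 : ℝ)) | past X n] =ᵐ[P]
      P[(X (n + 1) ⁻¹' B).indicator (fun _ => (1 : ℝ)) |
        MeasurableSpace.comap (X n) inferInstance]

/-- `X = (X n)`, `n ∈ ℤ`, is a (stationary) Markov chain generated by the copula `C`: every `X n`
is uniformly distributed on `[0,1]`, the joint distribution function of each pair
`(X n, X (n+1))` of consecutive variables is `C`, and `X` has the Markov property. -/
structure IsMarkovChainGeneratedBy (C : ℝ → ℝ → ℝ) (P : Measure Ω) (X : ℤ → Ω → ℝ) :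
    Prop where
  measurable : ∀ n, Measurable (X n)
  uniform : ∀ n, P.map (X n) = volume.restrict (Icc (0 : ℝ) 1)
  copula : ∀ n, ∀ x ∈ Icc (0 : ℝ) 1, ∀ y ∈ Icc (0 : ℝ) 1,
    P.real {ω | X n ω ≤ x ∧ X (n + 1) ω ≤ y} = C x y
  markov : HasMarkovProperty P X

/-- The strong mixing coefficient of two σ-algebras,
`α(𝒜, ℬ) = sup {|P(A ∩ B) - P(A) P(B)| : A ∈ 𝒜, B ∈ ℬ}`. -/
noncomputable def alpha (P : Measure Ω) (𝒜 ℬ : MeasurableSpace Ω) : ℝ :=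
  sSup {r : ℝ | ∃ A B : Set Ω, MeasurableSet[𝒜] A ∧ MeasurableSet[ℬ] B ∧
    r = |P.real (A ∩ B) - P.real A * P.real B|}

/-- `α n → 0` as `n → ∞`, where `α n = α(σ(X i, i ≤ 0), σ(X i, i ≥ n))`. -/
def IsAlphaMixing (P : Measure Ω) (X : ℤ → Ω → ℝ) : Prop :=
  Tendsto (fun n : ℕ => alpha P (past X 0) (future X (n : ℤ))) atTop (𝓝 0)

end Chain

/-- Every Markov chain generated by `C`, on whatever probability space, is `α`-mixing. -/
def GeneratesAlphaMixing (C : ℝ → ℝ → ℝ) : Prop :=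
  ∀ (Ω : Type u) [MeasurableSpace Ω] (P : Measure Ω) [IsProbabilityMeasure P]
    (X : ℤ → Ω → ℝ), IsMarkovChainGeneratedBy C P X → IsAlphaMixing P X

end CopulaChain

/-! Let `T` be the transition operator of a copula on bounded Borel functions. For a chain generated
by the copula, α-mixing is equivalent to `T ^ n f → 0` in L², uniformly over centred `f` with `|f| ≤
1`. In one direction the squared norm of `T ^ n f` is the covariance of `(T ^ n f) (X 0)` and `f (X
n)`, hence at most four times the `n`-th mixing coefficient (`energy_le_alpha`). In the other,
duality bounds that coefficient by twice the L¹ norm of `T ^ n f` for suitable `f` (`alpha_le`).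

In this form the property passes to mixtures. The operator of `∑ a j * C j` is `S = ∑ a j • T j`,
and each `T j` is an L² contraction because the uniform law is invariant. In the expansion of `S ^
m` the word `T i ^ m` has weight `c = a i ^ m`, so convexity bounds the energy of `S ^ m f` by `c`
times that of `T i ^ m f` plus `1 - c` times that of `f` (`energy_pow_sum_le`). If `m` makes the
first energy uniformly small, iterating over blocks of length `m` makes the whole small
(`tendsto_pow_sum`). A single mixing component of positive weight suffices.

Mixing of `C i` is a hypothesis on all chains it generates, so the operator bound can be extracted
only from an actual chain. `IsCopula.exists_chain` supplies one: the copula is disintegrated into a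
kernel, and a stationary two-sided chain is built from it. -/

namespace CopulaChain

/-! ### Distribution functions on the unit interval. -/

/-- The uniform distribution on `[0,1]`. -/
noncomputable abbrev unif : Measure ℝ := volume.restrict (Icc (0 : ℝ) 1)

instance isProbabilityMeasure_unif : IsProbabilityMeasure unif := ⟨by simp [unif]⟩

/-- The projection of the real line onto `[0,1]`. -/
noncomputable def clamp (x : ℝ) : ℝ := max 0 (min x 1)

lemma clamp_mem (x : ℝ) : clamp x ∈ Icc (0 : ℝ) 1 := by
  unfold clamp; constructor <;> grind

lemma clamp_of_mem {x : ℝ} (hx : x ∈ Icc (0 : ℝ) 1) : clamp x = x := by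
  obtain ⟨h0, h1⟩ := hx
  unfold clamp; grind

lemma clamp_of_nonpos {x : ℝ} (hx : x ≤ 0) : clamp x = 0 := by
  unfold clamp; grind

lemma clamp_of_one_le {x : ℝ} (hx : 1 ≤ x) : clamp x = 1 := by
  unfold clamp; grind

lemma monotone_clamp : Monotone clamp := fun x y h => by
  unfold clamp; grind

lemma continuous_clamp : Continuous clamp := by
  unfold clamp; fun_prop

lemma unif_Iic (x : ℝ) : unif (Iic x) = ENNReal.ofReal (clamp x) := by
  rw [unif, Measure.restrict_apply measurableSet_Iic]
  rcases lt_or_ge x 0 with h | h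
  · rw [clamp_of_nonpos h.le]
    have : Iic x ∩ Icc (0 : ℝ) 1 = ∅ := by
      ext z; simp only [mem_inter_iff, mem_Iic, mem_Icc, mem_empty_iff_false]; grind
    simp [this]
  · have : Iic x ∩ Icc (0 : ℝ) 1 = Icc 0 (clamp x) := by
      ext z; simp only [mem_inter_iff, mem_Iic, mem_Icc, clamp]; grind
    rw [this]; simp

/-- Finite measures carried by `[0,1]` are determined by their distribution functions on `[0,1]`. -/
lemma ext_of_Iic_of_mem_unit {ν₁ ν₂ : Measure ℝ} [IsFiniteMeasure ν₁]
    (h₁ : ν₁ (Icc (0 : ℝ) 1)ᶜ = 0) (h₂ : ν₂ (Icc (0 : ℝ) 1)ᶜ = 0)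
    (h : ∀ y ∈ Icc (0 : ℝ) 1, ν₁ (Iic y) = ν₂ (Iic y)) : ν₁ = ν₂ := by
  refine Measure.ext_of_Iic ν₁ ν₂ fun y => ?_
  rcases lt_or_ge y 0 with hy | hy
  · have hsub : Iic y ⊆ (Icc (0 : ℝ) 1)ᶜ := fun z hz hz' => by
      simp only [mem_Iic, mem_Icc] at hz hz'; linarith
    rw [measure_mono_null hsub h₁, measure_mono_null hsub h₂]
  rcases le_or_gt y 1 with hy1 | hy1
  · exact h y ⟨hy, hy1⟩
  · have key : ∀ ν : Measure ℝ, ν (Icc (0 : ℝ) 1)ᶜ = 0 → ν (Iic y) = ν (Iic 1) := by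
      intro ν hν
      refine measure_congr ?_
      have : ∀ᵐ z ∂ν, z ∈ Icc (0 : ℝ) 1 := by rw [ae_iff]; exact hν
      filter_upwards [this] with z hz
      refine propext ⟨fun _ => hz.2, fun _ => hz.2.trans hy1.le⟩
    rw [key ν₁ h₁, key ν₂ h₂]
    exact h 1 (by simp)

/-! ### Regularity of copulas; section measures and their densities. -/

variable {C : ℝ → ℝ → ℝ}

lemma IsCopula.rect_clamp (hC : IsCopula C) {a b c d : ℝ} (hab : a ≤ b) (hcd : c ≤ d) :
    0 ≤ C (clamp a) (clamp c) + C (clamp b) (clamp d) - C (clamp a) (clamp d)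
      - C (clamp b) (clamp c) :=
  hC.rect_nonneg _ _ _ _ (clamp_mem a).1 (monotone_clamp hab) (clamp_mem b).2 (clamp_mem c).1
    (monotone_clamp hcd) (clamp_mem d).2

lemma IsCopula.monotone_left (hC : IsCopula C) (y : ℝ) :
    Monotone fun x => C (clamp x) (clamp y) := fun a b hab => by
  -- `min 0 y` lies below `y` and clamps to `0`, where the copula vanishes. In the Lipschitz bounds
  -- `max 1 y` plays the same role at the top edge.
  have h := hC.rect_clamp hab (min_le_right 0 y)
  rw [clamp_of_nonpos (min_le_left 0 y), hC.zero_right _ (clamp_mem _),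
    hC.zero_right _ (clamp_mem _)] at h
  show C (clamp a) (clamp y) ≤ C (clamp b) (clamp y)
  linarith

lemma IsCopula.sub_left_le (hC : IsCopula C) (y : ℝ) {a b : ℝ} (hab : a ≤ b) :
    C (clamp b) (clamp y) - C (clamp a) (clamp y) ≤ clamp b - clamp a := by
  have h := hC.rect_clamp hab (le_max_right 1 y)
  rw [clamp_of_one_le (le_max_left 1 y), hC.one_right _ (clamp_mem _),
    hC.one_right _ (clamp_mem _)] at h
  linarith

lemma IsCopula.monotone_right (hC : IsCopula C) (x : ℝ) :
    Monotone fun y => C (clamp x) (clamp y) := fun a b hab => by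
  have h := hC.rect_clamp (min_le_right 0 x) hab
  rw [clamp_of_nonpos (min_le_left 0 x), hC.zero_left _ (clamp_mem _),
    hC.zero_left _ (clamp_mem _)] at h
  show C (clamp x) (clamp a) ≤ C (clamp x) (clamp b)
  linarith

lemma IsCopula.sub_right_le (hC : IsCopula C) (x : ℝ) {a b : ℝ} (hab : a ≤ b) :
    C (clamp x) (clamp b) - C (clamp x) (clamp a) ≤ clamp b - clamp a := by
  have h := hC.rect_clamp (le_max_right 1 x) hab
  rw [clamp_of_one_le (le_max_left 1 x), hC.one_left _ (clamp_mem _),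
    hC.one_left _ (clamp_mem _)] at h
  linarith

lemma IsCopula.continuous_left (hC : IsCopula C) (y : ℝ) :
    Continuous fun x => C (clamp x) (clamp y) := by
  have hL : LipschitzWith 1 fun x => C (clamp x) (clamp y) := by
    refine LipschitzWith.of_le_add fun a b => ?_
    rcases le_total a b with h | h
    · have := hC.monotone_left y h
      simp only at this
      have := dist_nonneg (x := a) (y := b)
      linarith
    · have := hC.sub_left_le y h
      have h2 : clamp a - clamp b ≤ a - b := by unfold clamp; grind
      rw [Real.dist_eq]
      have := le_abs_self (a - b)
      linarith
  exact hL.continuous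

lemma IsCopula.continuous_right (hC : IsCopula C) (x : ℝ) :
    Continuous fun y => C (clamp x) (clamp y) := by
  have hL : LipschitzWith 1 fun y => C (clamp x) (clamp y) := by
    refine LipschitzWith.of_le_add fun a b => ?_
    rcases le_total a b with h | h
    · have := hC.monotone_right x h
      simp only at this
      have := dist_nonneg (x := a) (y := b)
      linarith
    · have := hC.sub_right_le x h
      have h2 : clamp a - clamp b ≤ a - b := by unfold clamp; grind
      rw [Real.dist_eq]
      have := le_abs_self (a - b)
      linarith
  exact hL.continuous

/-- The distribution function `x ↦ C(x, y)` of the measure `B ↦ P(U ∈ B, V ≤ y)`. -/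
noncomputable def IsCopula.sectionFun (hC : IsCopula C) (y : ℝ) : StieltjesFunction ℝ where
  toFun x := C (clamp x) (clamp y)
  mono' := hC.monotone_left y
  right_continuous' _ := (hC.continuous_left y).continuousWithinAt

lemma IsCopula.sectionFun_apply (hC : IsCopula C) (y x : ℝ) :
    hC.sectionFun y x = C (clamp x) (clamp y) := rfl

lemma IsCopula.sectionFun_measure_Iic (hC : IsCopula C) (y x : ℝ) :
    (hC.sectionFun y).measure (Iic x) = ENNReal.ofReal (C (clamp x) (clamp y)) := by
  have hlim : Tendsto (hC.sectionFun y) atBot (𝓝 0) := by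
    refine tendsto_const_nhds.congr' ?_
    filter_upwards [eventually_le_atBot (0 : ℝ)] with z hz
    rw [hC.sectionFun_apply, clamp_of_nonpos hz, hC.zero_left _ (clamp_mem _)]
  rw [StieltjesFunction.measure_Iic _ hlim, sub_zero, hC.sectionFun_apply]

/-- The rectangle inequality makes the difference of two sections monotone, so it is itself the
distribution function of a measure. -/
lemma IsCopula.sectionFun_measure_mono (hC : IsCopula C) {y y' : ℝ} (h : y ≤ y') :
    (hC.sectionFun y).measure ≤ (hC.sectionFun y').measure := by
  let D : StieltjesFunction ℝ :=
    { toFun := fun x => C (clamp x) (clamp y') - C (clamp x) (clamp y)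
      mono' := fun a b hab => by
        have := hC.rect_clamp hab h
        show C (clamp a) (clamp y') - C (clamp a) (clamp y)
          ≤ C (clamp b) (clamp y') - C (clamp b) (clamp y)
        linarith
      right_continuous' := fun _ =>
        ((hC.continuous_left y').sub (hC.continuous_left y)).continuousWithinAt }
  have hD : hC.sectionFun y' = hC.sectionFun y + D := by
    ext x
    show C (clamp x) (clamp y') = C (clamp x) (clamp y)
      + (C (clamp x) (clamp y') - C (clamp x) (clamp y))
    ring
  rw [hD, StieltjesFunction.measure_add]
  exact Measure.le_add_right le_rfl

lemma IsCopula.sectionFun_measure_of_one_le (hC : IsCopula C) {y : ℝ} (hy : 1 ≤ y) :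
    (hC.sectionFun y).measure = unif := by
  symm
  refine Measure.ext_of_Iic _ _ fun x => ?_
  rw [hC.sectionFun_measure_Iic, unif_Iic, clamp_of_one_le hy, hC.one_right _ (clamp_mem _)]

lemma IsCopula.sectionFun_measure_of_nonpos (hC : IsCopula C) {y : ℝ} (hy : y ≤ 0) :
    (hC.sectionFun y).measure = 0 := by
  have : hC.sectionFun y = 0 := by
    ext x
    rw [hC.sectionFun_apply, clamp_of_nonpos hy, hC.zero_right _ (clamp_mem _)]; rfl
  rw [this, StieltjesFunction.measure_zero]

lemma IsCopula.sectionFun_measure_le (hC : IsCopula C) (y : ℝ) :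
    (hC.sectionFun y).measure ≤ unif := by
  rw [← hC.sectionFun_measure_of_one_le (le_max_right y 1)]
  exact hC.sectionFun_measure_mono (le_max_left y 1)

lemma IsCopula.isFiniteMeasure_sectionFun (hC : IsCopula C) (y : ℝ) :
    IsFiniteMeasure (hC.sectionFun y).measure :=
  ⟨(hC.sectionFun_measure_le y univ).trans_lt (measure_lt_top _ _)⟩

lemma IsCopula.sectionFun_measure_univ (hC : IsCopula C) (y : ℝ) :
    (hC.sectionFun y).measure univ = ENNReal.ofReal (clamp y) := by
  have h0 : Tendsto (hC.sectionFun y) atBot (𝓝 0) := by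
    refine tendsto_const_nhds.congr' ?_
    filter_upwards [eventually_le_atBot (0 : ℝ)] with z hz
    rw [hC.sectionFun_apply, clamp_of_nonpos hz, hC.zero_left _ (clamp_mem _)]
  have h1 : Tendsto (hC.sectionFun y) atTop (𝓝 (clamp y)) := by
    refine tendsto_const_nhds.congr' ?_
    filter_upwards [eventually_ge_atTop (1 : ℝ)] with z hz
    rw [hC.sectionFun_apply, clamp_of_one_le hz, hC.one_left _ (clamp_mem _)]
  rw [StieltjesFunction.measure_univ _ h0 h1, sub_zero]

/-- The density of `B ↦ P(U ∈ B, V ≤ y)`, a version of `P(V ≤ y | U = x)`. -/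
noncomputable def IsCopula.density (hC : IsCopula C) (y : ℝ) : ℝ → ENNReal :=
  (hC.sectionFun y).measure.rnDeriv unif

lemma IsCopula.measurable_density (hC : IsCopula C) (y : ℝ) : Measurable (hC.density y) :=
  Measure.measurable_rnDeriv _ _

lemma IsCopula.setLIntegral_density (hC : IsCopula C) (y : ℝ) (s : Set ℝ) :
    ∫⁻ x in s, hC.density y x ∂unif = (hC.sectionFun y).measure s := by
  have := hC.isFiniteMeasure_sectionFun y
  exact Measure.setLIntegral_rnDeriv
    (Measure.absolutelyContinuous_of_le (hC.sectionFun_measure_le y)) s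

lemma IsCopula.lintegral_density (hC : IsCopula C) (y : ℝ) :
    ∫⁻ x, hC.density y x ∂unif = ENNReal.ofReal (clamp y) := by
  rw [← setLIntegral_univ, hC.setLIntegral_density, hC.sectionFun_measure_univ]

lemma IsCopula.density_mono (hC : IsCopula C) {y y' : ℝ} (h : y ≤ y') :
    hC.density y ≤ᵐ[unif] hC.density y' := by
  refine ae_le_of_forall_setLIntegral_le_of_sigmaFinite (hC.measurable_density y)
    fun s _ _ => ?_
  rw [hC.setLIntegral_density, hC.setLIntegral_density]
  exact hC.sectionFun_measure_mono h s

lemma IsCopula.density_of_one_le (hC : IsCopula C) {y : ℝ} (hy : 1 ≤ y) :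
    hC.density y =ᵐ[unif] 1 := by
  rw [IsCopula.density, hC.sectionFun_measure_of_one_le hy]
  exact Measure.rnDeriv_self _

lemma IsCopula.density_of_nonpos (hC : IsCopula C) {y : ℝ} (hy : y ≤ 0) :
    hC.density y =ᵐ[unif] 0 := by
  rw [IsCopula.density, hC.sectionFun_measure_of_nonpos hy]
  exact Measure.rnDeriv_zero _

/-- Right continuity in the level. The infimum dominates the density by monotonicity, and its
integral is no larger because `clamp` is continuous; hence the two agree almost everywhere. -/
lemma IsCopula.iInf_density (hC : IsCopula C) (t : ℚ) :
    (fun x => ⨅ r : Ioi t, hC.density ((r : ℚ) : ℝ) x) =ᵐ[unif] hC.density t := by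
  symm
  refine ae_eq_of_ae_le_of_lintegral_le ?_ ?_ ?_ ?_
  · have : ∀ᵐ x ∂unif, ∀ r : Ioi t, hC.density t x ≤ hC.density ((r : ℚ) : ℝ) x := by
      rw [ae_all_iff]
      intro r
      exact hC.density_mono (by exact_mod_cast (le_of_lt r.2))
    filter_upwards [this] with x hx using le_iInf hx
  · rw [hC.lintegral_density]; exact ENNReal.ofReal_ne_top
  · exact (Measurable.iInf fun r => hC.measurable_density _).aemeasurable
  · rw [hC.lintegral_density]
    have hle : ∀ r : ℚ, t < r → ∫⁻ x, ⨅ r : Ioi t, hC.density ((r : ℚ) : ℝ) x ∂unif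
        ≤ ENNReal.ofReal (clamp r) := fun r hr => by
      rw [← hC.lintegral_density]
      exact lintegral_mono fun x => iInf_le_of_le ⟨r, hr⟩ le_rfl
    have hcont : Tendsto (fun n : ℕ => ENNReal.ofReal (clamp ((t : ℝ) + 1 / ((n : ℝ) + 1))))
        atTop (𝓝 (ENNReal.ofReal (clamp (t + 0)))) := by
      refine (ENNReal.continuous_ofReal.comp continuous_clamp).continuousAt.tendsto.comp ?_
      exact tendsto_const_nhds.add tendsto_one_div_add_atTop_nhds_zero_nat
    rw [add_zero] at hcont
    refine ge_of_tendsto' hcont fun n => ?_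
    have := hle (t + 1 / ((n : ℚ) + 1)) (by
      have : (0 : ℚ) < 1 / ((n : ℚ) + 1) := by positivity
      linarith)
    push_cast at this
    exact this

/-! ### Disintegration of a copula into a transition kernel. -/

/-- The rational conditional distribution functions of a copula. -/
noncomputable def IsCopula.ratCDF (hC : IsCopula C) (x : ℝ) (q : ℚ) : ℝ :=
  (hC.density q x).toReal

lemma IsCopula.measurable_ratCDF (hC : IsCopula C) : Measurable hC.ratCDF :=
  measurable_pi_lambda _ fun _ => (hC.measurable_density _).ennreal_toReal

lemma IsCopula.density_le_one (hC : IsCopula C) (y : ℝ) :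
    hC.density y ≤ᵐ[unif] 1 :=
  (hC.density_mono (le_max_left y 1)).trans (hC.density_of_one_le (le_max_right y 1)).le

lemma IsCopula.ae_isRatStieltjesPoint (hC : IsCopula C) :
    ∀ᵐ x ∂unif, IsRatStieltjesPoint hC.ratCDF x := by
  have h1 : ∀ᵐ x ∂unif, ∀ q : ℚ, hC.density q x ≤ 1 :=
    ae_all_iff.2 fun q => hC.density_le_one q
  have h2 : ∀ᵐ x ∂unif, ∀ q r : ℚ, q ≤ r → hC.density q x ≤ hC.density r x := by
    refine ae_all_iff.2 fun q => ae_all_iff.2 fun r => ?_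
    by_cases h : q ≤ r
    · filter_upwards [hC.density_mono (y := q) (y' := r) (by exact_mod_cast h)] with x hx _ using hx
    · exact Eventually.of_forall fun x h' => absurd h' h
  have h3 : ∀ᵐ x ∂unif, ∀ q : ℚ, 1 ≤ q → hC.density q x = 1 := by
    refine ae_all_iff.2 fun q => ?_
    by_cases h : 1 ≤ q
    · filter_upwards [hC.density_of_one_le (y := q) (by exact_mod_cast h)] with x hx _ using hx
    · exact Eventually.of_forall fun x h' => absurd h' h
  have h4 : ∀ᵐ x ∂unif, ∀ q : ℚ, q ≤ 0 → hC.density q x = 0 := by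
    refine ae_all_iff.2 fun q => ?_
    by_cases h : q ≤ 0
    · filter_upwards [hC.density_of_nonpos (y := q) (by exact_mod_cast h)] with x hx _ using hx
    · exact Eventually.of_forall fun x h' => absurd h' h
  have h5 : ∀ᵐ x ∂unif, ∀ t : ℚ, ⨅ r : Ioi t, hC.density ((r : ℚ) : ℝ) x = hC.density t x :=
    ae_all_iff.2 fun t => hC.iInf_density t
  filter_upwards [h1, h2, h3, h4, h5] with x h1 h2 h3 h4 h5
  have hfin : ∀ q : ℚ, hC.density q x ≠ ⊤ := fun q => ((h1 q).trans_lt ENNReal.one_lt_top).ne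
  refine ⟨fun q r hqr => ENNReal.toReal_mono (hfin r) (h2 q r hqr), ?_, ?_, fun t => ?_⟩
  · refine tendsto_const_nhds.congr' ?_
    filter_upwards [eventually_ge_atTop (1 : ℚ)] with q hq
    simp [IsCopula.ratCDF, h3 q hq]
  · refine tendsto_const_nhds.congr' ?_
    filter_upwards [eventually_le_atBot (0 : ℚ)] with q hq
    simp [IsCopula.ratCDF, h4 q hq]
  · simp only [IsCopula.ratCDF]
    rw [← h5 t]
    exact (ENNReal.toReal_iInf fun r : Ioi t => hfin r).symm

/-- The transition kernel of a copula. -/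
noncomputable def IsCopula.kernel (hC : IsCopula C) : Kernel ℝ ℝ where
  toFun x := (stieltjesOfMeasurableRat hC.ratCDF hC.measurable_ratCDF x).measure
  measurable' := measurable_measure_stieltjesOfMeasurableRat hC.measurable_ratCDF

instance IsCopula.isMarkovKernel_kernel (hC : IsCopula C) : IsMarkovKernel hC.kernel :=
  ⟨fun x => instIsProbabilityMeasure_stieltjesOfMeasurableRat hC.measurable_ratCDF x⟩

lemma IsCopula.kernel_Iic_rat (hC : IsCopula C) (q : ℚ) :
    (fun x => hC.kernel x (Iic (q : ℝ))) =ᵐ[unif] hC.density q := by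
  filter_upwards [hC.ae_isRatStieltjesPoint, hC.density_le_one q] with x hx h1
  show (stieltjesOfMeasurableRat hC.ratCDF hC.measurable_ratCDF x).measure (Iic (q : ℝ)) = _
  rw [measure_stieltjesOfMeasurableRat_Iic, stieltjesOfMeasurableRat_eq,
    toRatCDF_of_isRatStieltjesPoint hx, IsCopula.ratCDF,
    ENNReal.ofReal_toReal (h1.trans_lt ENNReal.one_lt_top).ne]

/-- `κ` is a transition kernel of the copula `C`: the distribution function of `unif ⊗ κ` is `C`. -/
def IsKernelOf (κ : Kernel ℝ ℝ) (C : ℝ → ℝ → ℝ) : Prop :=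
  ∀ x ∈ Icc (0 : ℝ) 1, ∀ y ∈ Icc (0 : ℝ) 1,
    ∫⁻ z in Iic x, κ z (Iic y) ∂unif = ENNReal.ofReal (C x y)

/-- At rational levels the identity comes from the densities. A real level is squeezed between
rational ones: the left side is monotone, the right side continuous. -/
lemma IsCopula.isKernelOf_kernel (hC : IsCopula C) : IsKernelOf hC.kernel C := by
  intro x hx y hy
  have hrat : ∀ q : ℚ, ∫⁻ z in Iic x, hC.kernel z (Iic (q : ℝ)) ∂unif
      = ENNReal.ofReal (C (clamp x) (clamp q)) := fun q => by
    rw [← hC.sectionFun_measure_Iic, ← hC.setLIntegral_density]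
    exact lintegral_congr_ae (ae_restrict_of_ae (hC.kernel_Iic_rat q))
  have hmono : ∀ a b : ℝ, a ≤ b → ∫⁻ z in Iic x, hC.kernel z (Iic a) ∂unif
      ≤ ∫⁻ z in Iic x, hC.kernel z (Iic b) ∂unif := fun a b hab =>
    lintegral_mono fun z => measure_mono (Iic_subset_Iic.2 hab)
  have hcont : Continuous fun t => ENNReal.ofReal (C (clamp x) (clamp t)) :=
    ENNReal.continuous_ofReal.comp (hC.continuous_right x)
  have hval : C x y = C (clamp x) (clamp y) := by rw [clamp_of_mem hx, clamp_of_mem hy]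
  rw [hval]
  refine le_antisymm ?_ ?_
  · obtain ⟨w, -, hw, hlim⟩ := Real.exists_seq_rat_strictAnti_tendsto y
    refine ge_of_tendsto' ((hcont.tendsto y).comp hlim) fun n => ?_
    exact (hmono _ _ (hw n).le).trans (hrat _).le
  · obtain ⟨w, -, hw, hlim⟩ := Real.exists_seq_rat_strictMono_tendsto y
    refine le_of_tendsto' ((hcont.tendsto y).comp hlim) fun n => ?_
    exact (hrat _).ge.trans (hmono _ _ (hw n).le)

/-! ### Laws of one-sided Markov sequences. -/

lemma past_mono {Ω : Type*} (X : ℤ → Ω → ℝ) {n n' : ℤ} (h : n ≤ n') : past X n ≤ past X n' :=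
  iSup_mono fun _ => iSup_mono' fun hi => ⟨le_trans hi h, le_rfl⟩

lemma comap_le_past {Ω : Type*} (X : ℤ → Ω → ℝ) {i n : ℤ} (h : i ≤ n) :
    MeasurableSpace.comap (X i) inferInstance ≤ past X n :=
  le_iSup₂_of_le i h le_rfl

lemma measurable_past {Ω : Type*} (X : ℤ → Ω → ℝ) {i n : ℤ} (h : i ≤ n) : Measurable[past X n] (X i) :=
  Measurable.of_comap_le (comap_le_past X h)

/-- Finite measures on sequences are determined by their values on cylinders. -/
lemma ext_of_cylinder {ν₁ ν₂ : Measure (ℕ → ℝ)} [IsFiniteMeasure ν₁]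
    (h : ∀ (k : ℕ) (B : ℕ → Set ℝ), (∀ i, MeasurableSet (B i)) →
      ν₁ {x | ∀ i < k, x i ∈ B i} = ν₂ {x | ∀ i < k, x i ∈ B i}) : ν₁ = ν₂ := by
  classical
  refine ext_of_generate_finite _
    (generateFrom_squareCylinders (α := fun _ : ℕ => ℝ)).symm
    (isPiSystem_squareCylinders (fun _ => MeasurableSpace.isPiSystem_measurableSet) (by simp)) ?_ ?_
  · rintro S ⟨s, t, ht, rfl⟩
    have hs : (s : Set ℕ).pi t
        = {x | ∀ i < s.sup id + 1, x i ∈ (if i ∈ s then t i else univ)} := by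
      ext x
      simp only [Set.mem_pi, Finset.mem_coe, mem_ofPred_eq]
      refine ⟨fun H i _ => ?_, fun H i hi => ?_⟩
      · by_cases hi : i ∈ s
        · simpa [hi] using H i hi
        · simp [hi]
      · have := H i (Nat.lt_succ_of_le (Finset.le_sup (f := id) (Finset.mem_coe.1 hi)))
        rwa [if_pos (Finset.mem_coe.1 hi)] at this
    rw [hs]
    refine h _ _ fun i => ?_
    by_cases hi : i ∈ s
    · simpa [hi] using ht i (mem_univ i)
    · simp [hi]
  · simpa using h 0 (fun _ => univ) (fun _ => MeasurableSet.univ)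

section MarkovSeq

variable {Ω : Type*} [mΩ : MeasurableSpace Ω] {P : Measure Ω} {m : ℕ → MeasurableSpace Ω}
  {X : ℕ → Ω → ℝ} {κ : Kernel ℝ ℝ}

/-- `X` is a Markov chain with transition kernel `κ`, relative to the filtration `m`. -/
structure IsMarkovSeq (P : Measure Ω) (m : ℕ → MeasurableSpace Ω) (X : ℕ → Ω → ℝ)
    (κ : Kernel ℝ ℝ) : Prop where
  le : ∀ i, m i ≤ mΩ
  mono : ∀ i, m i ≤ m (i + 1)
  adapted : ∀ i, Measurable[m i] (X i)
  step : ∀ (i : ℕ) (f : Ω → ENNReal) (g : ℝ → ENNReal), Measurable[m i] f → Measurable g →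
    ∫⁻ ω, f ω * g (X (i + 1) ω) ∂P = ∫⁻ ω, f ω * ∫⁻ y, g y ∂κ (X i ω) ∂P

/-- The Markov property for events implies that for functions. -/
lemma lintegral_step_of_measure {Ω : Type*} {m₀ mΩ : MeasurableSpace Ω} {P : Measure Ω}
    (hm : m₀ ≤ mΩ) {U V : Ω → ℝ}
    (hU : Measurable[m₀] U) (hV : Measurable V)
    (h : ∀ (A : Set Ω) (B : Set ℝ), MeasurableSet[m₀] A → MeasurableSet B →
      P (A ∩ V ⁻¹' B) = ∫⁻ ω in A, κ (U ω) B ∂P)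
    {f : Ω → ENNReal} {g : ℝ → ENNReal} (hf : Measurable[m₀] f) (hg : Measurable g) :
    ∫⁻ ω, f ω * g (V ω) ∂P = ∫⁻ ω, f ω * ∫⁻ y, g y ∂κ (U ω) ∂P := by
  have hU' : Measurable U := hU.mono hm le_rfl
  have hf' : Measurable f := hf.mono hm le_rfl
  have hκ : ∀ B, MeasurableSet B → Measurable fun ω => κ (U ω) B := fun B hB =>
    (κ.measurable_coe hB).comp hU'
  have h1 : ∀ B, MeasurableSet B → ∫⁻ ω in V ⁻¹' B, f ω ∂P = ∫⁻ ω, f ω * κ (U ω) B ∂P := by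
    intro B hB
    -- For fixed `B` the hypothesis is an equality of two measures on `m₀`, so it may be integrated
    -- against any `m₀`-measurable `f`.
    have htrim : (P.restrict (V ⁻¹' B)).trim hm
        = (P.withDensity fun ω => κ (U ω) B).trim hm := by
      refine @Measure.ext _ m₀ _ _ fun A hA => ?_
      rw [trim_measurableSet_eq hm hA, trim_measurableSet_eq hm hA,
        Measure.restrict_apply (hm A hA), withDensity_apply _ (hm A hA), h A B hA hB]
    rw [← lintegral_trim hm hf, htrim, lintegral_trim hm hf,
      lintegral_withDensity_eq_lintegral_mul _ (hκ B hB) hf']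
    simp only [Pi.mul_apply, mul_comm]
  -- Now `f` is fixed and `B` varies: under the weight `f`, the law of `V` is the law of `U` pushed
  -- through `κ`.
  have h2 : (P.withDensity f).map V = ((P.withDensity f).map U).bind κ := by
    refine Measure.ext fun B hB => ?_
    rw [Measure.map_apply hV hB, withDensity_apply _ (hV hB), h1 B hB,
      Measure.bind_apply hB κ.measurable.aemeasurable, lintegral_map (κ.measurable_coe hB) hU',
      lintegral_withDensity_eq_lintegral_mul _ hf' (hκ B hB)]
    rfl
  have h3 : ∫⁻ y, g y ∂((P.withDensity f).map V)
      = ∫⁻ y, g y ∂(((P.withDensity f).map U).bind κ) := by rw [h2]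
  rw [lintegral_map hg hV, Measure.lintegral_bind κ.measurable.aemeasurable hg.aemeasurable,
    lintegral_map hg.lintegral_kernel hU',
    lintegral_withDensity_eq_lintegral_mul _ hf' (show Measurable fun ω => g (V ω) from hg.comp hV),
    lintegral_withDensity_eq_lintegral_mul _ hf'
      (show Measurable fun ω => ∫⁻ y, g y ∂κ (U ω) from hg.lintegral_kernel.comp hU')] at h3
  exact h3

lemma IsMarkovSeq.measurable (h : IsMarkovSeq P m X κ) (i : ℕ) : Measurable (X i) :=
  (h.adapted i).mono (h.le i) le_rfl

lemma IsMarkovSeq.measurable_path (h : IsMarkovSeq P m X κ) : Measurable fun ω i => X i ω :=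
  measurable_pi_lambda _ h.measurable

lemma IsMarkovSeq.shift (h : IsMarkovSeq P m X κ) :
    IsMarkovSeq P (fun i => m (i + 1)) (fun i => X (i + 1)) κ :=
  ⟨fun _ => h.le _, fun _ => h.mono _, fun _ => h.adapted _, fun _ => h.step _⟩

/-- The probability of `X 0 ∈ B 0, …, X (k - 1) ∈ B (k - 1)` for the chain started at `x`. -/
noncomputable def cylFun (κ : Kernel ℝ ℝ) : ℕ → (ℕ → Set ℝ) → ℝ → ENNReal
  | 0, _, _ => 1
  | k + 1, B, x => (B 0).indicator 1 x * ∫⁻ y, cylFun κ k (fun i => B (i + 1)) y ∂κ x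

lemma measurable_cylFun (κ : Kernel ℝ ℝ) (k : ℕ) {B : ℕ → Set ℝ}
    (hB : ∀ i, MeasurableSet (B i)) : Measurable (cylFun κ k B) := by
  induction k generalizing B with
  | zero => exact measurable_const
  | succ k ih =>
    exact (measurable_one.indicator (hB 0)).mul
      (Measurable.lintegral_kernel (ih fun i => hB (i + 1)))

/-- Induction on the length: the indicator at time `0` is absorbed into `f`, the shifted chain
handles the remaining factors, and one Markov step returns from `X 1` to `X 0`. -/
lemma IsMarkovSeq.lintegral_cylinder (h : IsMarkovSeq P m X κ) (k : ℕ) {B : ℕ → Set ℝ}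
    (hB : ∀ i, MeasurableSet (B i)) {f : Ω → ENNReal} (hf : Measurable[m 0] f) :
    ∫⁻ ω, f ω * ∏ i ∈ Finset.range k, (B i).indicator 1 (X i ω) ∂P
      = ∫⁻ ω, f ω * cylFun κ k B (X 0 ω) ∂P := by
  induction k generalizing B f X m with
  | zero => simp [cylFun]
  | succ k ih =>
    have hf0 : Measurable[m 0] fun ω => f ω * (B 0).indicator (1 : ℝ → ENNReal) (X 0 ω) :=
      hf.mul ((measurable_one.indicator (hB 0)).comp (h.adapted 0))
    have h1 := ih h.shift (fun i => hB (i + 1)) (hf0.mono (h.mono 0) le_rfl)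
    have h2 := h.step 0 _ _ hf0 (measurable_cylFun κ k fun i => hB (i + 1))
    calc _ = ∫⁻ ω, f ω * (B 0).indicator 1 (X 0 ω)
          * ∏ i ∈ Finset.range k, (B (i + 1)).indicator 1 (X (i + 1) ω) ∂P := by
          refine lintegral_congr fun ω => ?_
          rw [Finset.prod_range_succ', mul_assoc, mul_comm (Finset.prod _ _)]
      _ = _ := by
          rw [h1, h2]
          refine lintegral_congr fun ω => ?_
          rw [mul_assoc]; rfl

lemma indicator_cylinder (k : ℕ) (B : ℕ → Set ℝ) (x : ℕ → ℝ) :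
    {x : ℕ → ℝ | ∀ i < k, x i ∈ B i}.indicator (1 : (ℕ → ℝ) → ENNReal) x
      = ∏ i ∈ Finset.range k, (B i).indicator 1 (x i) := by
  classical
  by_cases hx : ∀ i < k, x i ∈ B i
  · rw [indicator_of_mem (by exact hx)]
    refine (Finset.prod_eq_one fun i hi => ?_).symm
    rw [indicator_of_mem (hx i (Finset.mem_range.1 hi))]; rfl
  · rw [indicator_of_notMem (by exact hx)]
    push Not at hx
    obtain ⟨i, hi, hxi⟩ := hx
    exact (Finset.prod_eq_zero (Finset.mem_range.2 hi) (indicator_of_notMem hxi _)).symm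

lemma measurableSet_cylinder (k : ℕ) {B : ℕ → Set ℝ} (hB : ∀ i, MeasurableSet (B i)) :
    MeasurableSet {x : ℕ → ℝ | ∀ i < k, x i ∈ B i} := by
  have : {x : ℕ → ℝ | ∀ i < k, x i ∈ B i} = ⋂ i, ⋂ (_ : i < k), (fun x => x i) ⁻¹' B i := by
    ext; simp
  rw [this]
  exact MeasurableSet.iInter fun i => MeasurableSet.iInter fun _ => measurable_pi_apply i (hB i)

/-- A weight `f` known at time `0` affects the law of the path only through the law of `X 0`. -/
lemma IsMarkovSeq.map_path_cylinder (h : IsMarkovSeq P m X κ) (k : ℕ) {B : ℕ → Set ℝ}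
    (hB : ∀ i, MeasurableSet (B i)) {f : Ω → ENNReal} (hf : Measurable[m 0] f) :
    (P.withDensity f).map (fun ω i => X i ω) {x | ∀ i < k, x i ∈ B i}
      = ∫⁻ y, cylFun κ k B y ∂((P.withDensity f).map (X 0)) := by
  have hf' : Measurable f := hf.mono (h.le 0) le_rfl
  have hS := measurableSet_cylinder k hB
  have hg₁ : Measurable fun ω => {x : ℕ → ℝ | ∀ i < k, x i ∈ B i}.indicator
      (1 : (ℕ → ℝ) → ENNReal) (fun i => X i ω) :=
    (measurable_one.indicator hS).comp h.measurable_path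
  have hg₂ : Measurable fun ω => cylFun κ k B (X 0 ω) :=
    (measurable_cylFun κ k hB).comp (h.measurable 0)
  rw [← lintegral_indicator_one hS,
    lintegral_map (measurable_one.indicator hS) h.measurable_path,
    lintegral_map (measurable_cylFun κ k hB) (h.measurable 0),
    lintegral_withDensity_eq_lintegral_mul _ hf' hg₁,
    lintegral_withDensity_eq_lintegral_mul _ hf' hg₂]
  simp only [Pi.mul_apply]
  rw [← h.lintegral_cylinder k hB hf]
  refine lintegral_congr fun ω => ?_
  rw [indicator_cylinder]

/-- The law of a Markov chain is determined by its kernel and its initial law. -/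
lemma IsMarkovSeq.map_path_eq {Ω' : Type*} [MeasurableSpace Ω'] {P' : Measure Ω'}
    {m' : ℕ → MeasurableSpace Ω'} {X' : ℕ → Ω' → ℝ}
    (h : IsMarkovSeq P m X κ) (h' : IsMarkovSeq P' m' X' κ)
    {f : Ω → ENNReal} (hf : Measurable[m 0] f) (hfin : ∫⁻ ω, f ω ∂P ≠ ⊤)
    {f' : Ω' → ENNReal} (hf' : Measurable[m' 0] f')
    (h0 : (P.withDensity f).map (X 0) = (P'.withDensity f').map (X' 0)) :
    (P.withDensity f).map (fun ω i => X i ω) = (P'.withDensity f').map (fun ω i => X' i ω) := by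
  have := isFiniteMeasure_withDensity hfin
  refine ext_of_cylinder fun k B hB => ?_
  rw [h.map_path_cylinder k hB hf, h'.map_path_cylinder k hB hf', h0]

end MarkovSeq

/-! ### Chains generated by a copula move by any of its kernels. -/

section Kernel

variable {C : ℝ → ℝ → ℝ} {κ : Kernel ℝ ℝ} [IsMarkovKernel κ]

/-- `IsKernelOf` prescribes values only on the unit square. No mass escapes: `Iic 0` receives `C x 0
= 0`, and `Iic 1` receives `C x 1 = x`, which is already everything. -/
lemma IsKernelOf.lintegral_compl (hC : IsCopula C) (hκ : IsKernelOf κ C) {x : ℝ}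
    (hx : x ∈ Icc (0 : ℝ) 1) : ∫⁻ z in Iic x, κ z (Icc (0 : ℝ) 1)ᶜ ∂unif = 0 := by
  have h0 : ∫⁻ z in Iic x, κ z (Iic 0) ∂unif = 0 := by
    rw [hκ x hx 0 (by simp), hC.zero_right x hx, ENNReal.ofReal_zero]
  have h1 : ∫⁻ z in Iic x, κ z (Ioi 1) ∂unif = 0 := by
    have hadd : ∫⁻ z in Iic x, κ z (Iic 1) ∂unif + ∫⁻ z in Iic x, κ z (Ioi 1) ∂unif
        = ENNReal.ofReal x := by
      rw [← lintegral_add_left (κ.measurable_coe measurableSet_Iic)]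
      have : ∀ z, κ z (Iic 1) + κ z (Ioi 1) = 1 := fun z => by
        rw [← compl_Iic, prob_add_prob_compl measurableSet_Iic]
      simp only [this]
      rw [setLIntegral_const, one_mul, unif_Iic, clamp_of_mem hx]
    rw [hκ x hx 1 (by simp), hC.one_right x hx] at hadd
    exact (ENNReal.add_right_inj ENNReal.ofReal_ne_top).1 (hadd.trans (add_zero _).symm)
  refine le_antisymm ?_ zero_le
  calc _ ≤ ∫⁻ z in Iic x, (κ z (Iic 0) + κ z (Ioi 1)) ∂unif := by
        refine lintegral_mono fun z => (measure_mono ?_).trans (measure_union_le _ _)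
        intro w hw
        simp only [mem_compl_iff, mem_Icc, mem_union, mem_Iic, mem_Ioi] at hw ⊢
        grind
    _ = 0 := by rw [lintegral_add_left (κ.measurable_coe measurableSet_Iic), h0, h1, add_zero]

lemma IsKernelOf.bind_unif (hC : IsCopula C) (hκ : IsKernelOf κ C) : unif.bind κ = unif := by
  have hr : ∀ g : ℝ → ENNReal, ∫⁻ z, g z ∂unif = ∫⁻ z in Iic 1, g z ∂unif := fun g => by
    rw [unif, Measure.restrict_restrict measurableSet_Iic, inter_eq_right.2 Icc_subset_Iic_self]
  refine (ext_of_Iic_of_mem_unit (by simp [unif]) ?_ fun y hy => ?_).symm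
  · rw [Measure.bind_apply measurableSet_Icc.compl κ.measurable.aemeasurable, hr]
    exact hκ.lintegral_compl hC (by simp)
  · rw [Measure.bind_apply measurableSet_Iic κ.measurable.aemeasurable, hr,
      hκ 1 (by simp) y hy, hC.one_left y hy, unif_Iic, clamp_of_mem hy]

variable {Ω : Type*} [mΩ : MeasurableSpace Ω] {P : Measure Ω} [IsProbabilityMeasure P]

/-- A pair of uniform variables with joint distribution function `C` has the law given by any
transition kernel of `C`. -/
lemma IsKernelOf.measure_inter (hC : IsCopula C) (hκ : IsKernelOf κ C) {U V : Ω → ℝ}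
    (hU : Measurable U) (hV : Measurable V) (hUu : P.map U = unif) (hVu : P.map V = unif)
    (hUV : ∀ x ∈ Icc (0 : ℝ) 1, ∀ y ∈ Icc (0 : ℝ) 1, P.real {ω | U ω ≤ x ∧ V ω ≤ y} = C x y)
    {A B : Set ℝ} (hA : MeasurableSet A) (hB : MeasurableSet B) :
    P (U ⁻¹' A ∩ V ⁻¹' B) = ∫⁻ x in A, κ x B ∂unif := by
  have hnull : unif (Icc (0 : ℝ) 1)ᶜ = 0 := by simp [unif]
  have hU0 : P (U ⁻¹' (Icc (0 : ℝ) 1)ᶜ) = 0 := by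
    rw [← Measure.map_apply hU measurableSet_Icc.compl, hUu, hnull]
  have hV0 : P (V ⁻¹' (Icc (0 : ℝ) 1)ᶜ) = 0 := by
    rw [← Measure.map_apply hV measurableSet_Icc.compl, hVu, hnull]
  -- Two extensions from half-lines to Borel sets: here in `V` with the half-line for `U` fixed,
  -- then in `h2` in `U` with the Borel set `B` fixed.
  have h1 : ∀ x ∈ Icc (0 : ℝ) 1,
      (P.restrict (U ⁻¹' Iic x)).map V = (unif.restrict (Iic x)).bind κ := by
    intro x hx
    refine ext_of_Iic_of_mem_unit ?_ ?_ fun y hy => ?_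
    · rw [Measure.map_apply hV measurableSet_Icc.compl]
      exact Measure.restrict_le_self.absolutelyContinuous hV0
    · rw [Measure.bind_apply measurableSet_Icc.compl κ.measurable.aemeasurable]
      exact hκ.lintegral_compl hC hx
    · rw [Measure.bind_apply measurableSet_Iic κ.measurable.aemeasurable, hκ x hx y hy,
        ← hUV x hx y hy, ofReal_measureReal, Measure.map_apply hV measurableSet_Iic,
        Measure.restrict_apply (hV measurableSet_Iic), inter_comm]
      rfl
  have h2 : (P.restrict (V ⁻¹' B)).map U = unif.withDensity fun x => κ x B := by
    refine ext_of_Iic_of_mem_unit ?_ ?_ fun x hx => ?_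
    · rw [Measure.map_apply hU measurableSet_Icc.compl]
      exact Measure.restrict_le_self.absolutelyContinuous hU0
    · exact withDensity_absolutelyContinuous _ _ hnull
    · have := congrArg (fun ν => ν B) (h1 x hx)
      rw [Measure.bind_apply hB κ.measurable.aemeasurable, Measure.map_apply hV hB,
        Measure.restrict_apply (hV hB)] at this
      rw [Measure.map_apply hU measurableSet_Iic, Measure.restrict_apply (hU measurableSet_Iic),
        withDensity_apply _ measurableSet_Iic, ← this, inter_comm]
  have := congrArg (fun ν => ν A) h2
  rwa [Measure.map_apply hU hA, Measure.restrict_apply (hU hA), withDensity_apply _ hA] at this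

/-- The conditional probability of `V ∈ B` is `κ(U, B)` exactly if integrating `κ(U, B)` yields the
right probabilities. -/
lemma condExp_indicator_ae_eq_iff {Ω : Type*} {m₀ mΩ : MeasurableSpace Ω} {P : Measure Ω}
    [IsProbabilityMeasure P] (hm : m₀ ≤ mΩ) {U V : Ω → ℝ}
    (hU : Measurable[m₀] U) (hV : Measurable V) {B : Set ℝ} (hB : MeasurableSet B) :
    P[(V ⁻¹' B).indicator (fun _ => (1 : ℝ)) | m₀] =ᵐ[P] (fun ω => (κ (U ω)).real B) ↔
      ∀ A, MeasurableSet[m₀] A → P (A ∩ V ⁻¹' B) = ∫⁻ ω in A, κ (U ω) B ∂P := by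
  have hκm : Measurable[m₀] fun ω => (κ (U ω)).real B :=
    ((κ.measurable_coe hB).comp hU).ennreal_toReal
  have hκi : Integrable (fun ω => (κ (U ω)).real B) P := by
    refine Integrable.of_bound (hκm.mono hm le_rfl).aestronglyMeasurable 1
      (Eventually.of_forall fun ω => ?_)
    rw [Real.norm_of_nonneg measureReal_nonneg]
    exact measureReal_le_one
  have hind : Integrable ((V ⁻¹' B).indicator (fun _ => (1 : ℝ))) P :=
    (integrable_const 1).indicator (hV hB)
  have h1 : ∀ A, MeasurableSet[m₀] A →
      ∫ ω in A, (V ⁻¹' B).indicator (fun _ => (1 : ℝ)) ω ∂P = P.real (A ∩ V ⁻¹' B) := by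
    intro A hA
    rw [setIntegral_indicator (hV hB), setIntegral_const, smul_eq_mul, mul_one]
  have h2 : ∀ A, MeasurableSet[m₀] A →
      ENNReal.ofReal (∫ ω in A, (κ (U ω)).real B ∂P) = ∫⁻ ω in A, κ (U ω) B ∂P := by
    intro A hA
    rw [ofReal_integral_eq_lintegral_ofReal hκi.integrableOn
      (Eventually.of_forall fun ω => measureReal_nonneg)]
    exact lintegral_congr fun ω => ofReal_measureReal
  constructor
  · intro h A hA
    rw [← h2 A hA, ← setIntegral_congr_ae (hm A hA) (h.mono fun ω hω _ => hω),
      setIntegral_condExp hm hind hA, h1 A hA, ofReal_measureReal]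
  · intro h
    refine (ae_eq_condExp_of_forall_setIntegral_eq hm hind (fun _ _ _ => hκi.integrableOn)
      (fun A hA _ => ?_) hκm.aestronglyMeasurable).symm
    rw [h1 A hA, measureReal_def, h A hA, ← h2 A hA, ENNReal.toReal_ofReal]
    exact integral_nonneg fun _ => measureReal_nonneg

lemma past_le {X : ℤ → Ω → ℝ} (hX : ∀ n, Measurable (X n)) (n : ℤ) : past X n ≤ mΩ :=
  iSup₂_le fun i _ => (hX i).comap_le

/-- The pair law identifies the conditional probability given `X n` as `κ (X n) B`; the Markov
property transfers this to the whole past. -/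
lemma IsMarkovChainGeneratedBy.measure_inter {X : ℤ → Ω → ℝ}
    (hX : IsMarkovChainGeneratedBy C P X) (hC : IsCopula C) (hκ : IsKernelOf κ C) (n : ℤ)
    {A : Set Ω} {B : Set ℝ} (hA : MeasurableSet[past X n] A) (hB : MeasurableSet B) :
    P (A ∩ X (n + 1) ⁻¹' B) = ∫⁻ ω in A, κ (X n ω) B ∂P := by
  refine (condExp_indicator_ae_eq_iff (κ := κ) (past_le hX.measurable n)
    (measurable_past X le_rfl) (hX.measurable (n + 1)) hB).1 ?_ A hA
  refine (hX.markov n B hB).trans ?_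
  refine (condExp_indicator_ae_eq_iff (κ := κ) (hX.measurable n).comap_le
    (comap_measurable _) (hX.measurable (n + 1)) hB).2 ?_
  rintro _ ⟨A', hA', rfl⟩
  rw [hκ.measure_inter hC (hX.measurable n) (hX.measurable _) (hX.uniform n) (hX.uniform _)
    (hX.copula n) hA' hB, unif, ← hX.uniform n, setLIntegral_map hA' (κ.measurable_coe hB)
    (hX.measurable n)]

/-- A Markov chain generated by `C`, watched from time `n` on. -/
lemma IsMarkovChainGeneratedBy.isMarkovSeq {X : ℤ → Ω → ℝ}
    (hX : IsMarkovChainGeneratedBy C P X) (hC : IsCopula C) (hκ : IsKernelOf κ C) (n : ℤ) :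
    IsMarkovSeq P (fun i => past X (n + i)) (fun i => X (n + i)) κ where
  le i := past_le hX.measurable _
  mono i := past_mono X (by push_cast; lia)
  adapted i := measurable_past X le_rfl
  step i f g hf hg := by
    have := lintegral_step_of_measure (κ := κ) (past_le hX.measurable (n + i))
      (measurable_past X le_rfl) (hX.measurable (n + i + 1))
      (fun A B hA hB => hX.measure_inter hC hκ (n + i) hA hB) hf hg
    push_cast
    rw [← add_assoc]
    exact this

end Kernel

/-! ### Existence of a chain generated by a given copula. -/

section OneSided

variable {E : Type*} [MeasurableSpace E]

/-- The σ-algebra on `ℕ → E` generated by the coordinates up to `n`. -/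
abbrev coordPast (E : Type*) [MeasurableSpace E] (n : ℕ) : MeasurableSpace (ℕ → E) :=
  MeasurableSpace.comap (Preorder.frestrictLe (π := fun _ => E) n) inferInstance

lemma coordPast_le (n : ℕ) : coordPast E n ≤ (inferInstance : MeasurableSpace (ℕ → E)) :=
  (Preorder.measurable_frestrictLe n).comap_le

lemma measurable_coordPast {i n : ℕ} (h : i ≤ n) :
    Measurable[coordPast E n] fun x : ℕ → E => x i := by
  have : (fun x : ℕ → E => x i)
      = (fun y : (Finset.Iic n) → E => y ⟨i, Finset.mem_Iic.2 h⟩)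
        ∘ Preorder.frestrictLe (π := fun _ => E) n := rfl
  rw [this]
  exact (measurable_pi_apply _).comp (comap_measurable _)

lemma coordPast_mono (n : ℕ) : coordPast E n ≤ coordPast E (n + 1) :=
  Measurable.comap_le <| @measurable_pi_lambda _ _ _ (coordPast E (n + 1)) _ _ fun i =>
    measurable_coordPast ((Finset.mem_Iic.1 i.2).trans n.le_succ)

/-- Existence of one-sided Markov chains with given initial law and kernel. -/
lemma exists_oneSided (μ : Measure E) [IsProbabilityMeasure μ] (κ : Kernel E E)
    [IsMarkovKernel κ] :
    ∃ M : Measure (ℕ → E), IsProbabilityMeasure M ∧ M.map (fun x => x 0) = μ ∧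
      ∀ (n : ℕ) (A : Set (ℕ → E)) (B : Set E), MeasurableSet[coordPast E n] A →
        MeasurableSet B → M (A ∩ (fun x => x (n + 1)) ⁻¹' B) = ∫⁻ x in A, κ (x n) B ∂M := by
  -- The Ionescu-Tulcea construction takes kernels depending on the whole history; these read only
  -- its last coordinate.
  let K : (n : ℕ) → Kernel ((i : Finset.Iic n) → (fun _ : ℕ => E) i) ((fun _ : ℕ => E) (n + 1)) :=
    fun n => κ.comap (fun y => y ⟨n, Finset.mem_Iic.2 le_rfl⟩) (measurable_pi_apply _)
  have hK : ∀ n, IsMarkovKernel (K n) := fun n => Kernel.IsMarkovKernel.comap _ _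
  let M : Measure (ℕ → E) := Kernel.trajMeasure (X := fun _ : ℕ => E) μ K
  have hM : IsProbabilityMeasure M := by infer_instance
  refine ⟨M, hM, ?_, fun n A B hA hB => ?_⟩
  · have h0 : (fun x : ℕ → E => x 0)
        = (fun y : (Finset.Iic 0) → E => y ⟨0, Finset.mem_Iic.2 le_rfl⟩)
          ∘ Preorder.frestrictLe (π := fun _ => E) 0 := rfl
    have hev : Measurable fun y : (Finset.Iic 0) → E => y ⟨0, Finset.mem_Iic.2 le_rfl⟩ :=
      measurable_pi_apply _
    rw [h0, ← Measure.map_map hev (Preorder.measurable_frestrictLe 0)]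
    have h1 : M.map (Preorder.frestrictLe (π := fun _ => E) 0)
        = μ.map (MeasurableEquiv.piUnique (fun _ : Finset.Iic 0 => E)).symm := by
      show (Kernel.trajMeasure (X := fun _ : ℕ => E) μ K).map _ = _
      rw [Kernel.trajMeasure, Measure.map_comp _ _ (Preorder.measurable_frestrictLe 0),
        Kernel.traj_map_frestrictLe, Kernel.partialTraj_self, Measure.id_comp]
    rw [h1, Measure.map_map hev (MeasurableEquiv.measurable _)]
    have h2 : ((fun y : (Finset.Iic 0) → E => y ⟨0, Finset.mem_Iic.2 le_rfl⟩)
        ∘ (MeasurableEquiv.piUnique (fun _ : Finset.Iic 0 => E)).symm) = id := by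
      funext x; rfl
    rw [h2, Measure.map_id]
  · obtain ⟨A', hA', rfl⟩ := hA
    have h := Kernel.map_frestrictLe_trajMeasure_compProd_eq_map_trajMeasure
      (X := fun _ : ℕ => E) (μ₀ := μ) (κ := K) (a := n)
    have h' := congrArg (fun ν => ν (A' ×ˢ B)) h
    rw [Measure.compProd_apply_prod hA' hB, setLIntegral_map hA' ((K n).measurable_coe hB)
      (Preorder.measurable_frestrictLe n), Measure.map_apply (by fun_prop) (hA'.prod hB)] at h'
    exact h'.symm

end OneSided

section Stationary

/-- The left shift of a sequence. -/
def seqShift (x : ℕ → ℝ) : ℕ → ℝ := fun i => x (i + 1)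

lemma measurable_seqShift : Measurable seqShift :=
  measurable_pi_lambda _ fun i => measurable_pi_apply (i + 1)

variable {κ : Kernel ℝ ℝ}

/-- A one-sided chain started from an invariant law is stationary. -/
lemma map_seqShift_eq {M : Measure (ℕ → ℝ)} [IsProbabilityMeasure M]
    (hinv : (M.map fun x => x 0).bind κ = M.map fun x => x 0)
    (hstep : ∀ (n : ℕ) (A : Set (ℕ → ℝ)) (B : Set ℝ), MeasurableSet[coordPast ℝ n] A →
        MeasurableSet B → M (A ∩ (fun x => x (n + 1)) ⁻¹' B) = ∫⁻ x in A, κ (x n) B ∂M) :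
    M.map seqShift = M := by
  have hseq : IsMarkovSeq M (coordPast ℝ) (fun i x => x i) κ :=
    ⟨coordPast_le, coordPast_mono, fun i => measurable_coordPast le_rfl,
      fun i f g hf hg => lintegral_step_of_measure (coordPast_le i) (measurable_coordPast le_rfl)
        (measurable_pi_apply (i + 1)) (hstep i) hf hg⟩
  have h1 : M.map (fun x => x 1) = M.map fun x => x 0 := by
    rw [← hinv]
    refine Measure.ext fun B hB => ?_
    have := hstep 0 univ B MeasurableSet.univ hB
    rw [univ_inter, setLIntegral_univ] at this
    rw [Measure.map_apply (measurable_pi_apply 1) hB, this,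
      Measure.bind_apply hB κ.measurable.aemeasurable,
      lintegral_map (κ.measurable_coe hB) (measurable_pi_apply 0)]
  have := hseq.shift.map_path_eq hseq (f := fun _ => 1) (f' := fun _ => 1)
    measurable_const (by simp) measurable_const
    (by simpa only [← Pi.one_def, withDensity_one] using h1)
  rw [← Pi.one_def, withDensity_one] at this
  exact this.trans Measure.map_id

end Stationary

section TwoSided

/-- A stationary law on one-sided sequences extends to a two-sided process. -/
lemma exists_twoSided {M : Measure (ℕ → ℝ)} [IsProbabilityMeasure M]
    (hM : M.map seqShift = M) :
    ∃ (Q : Measure (ℕ → ℕ → ℝ)) (X : ℤ → (ℕ → ℕ → ℝ) → ℝ), IsProbabilityMeasure Q ∧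
      (∀ n, Measurable (X n)) ∧ ∀ N : ℕ, Q.map (fun ω (i : ℕ) => X (i - N) ω) = M := by
  -- `L` draws a sequence given its shift, that is, it prepends one earlier coordinate. Running a
  -- chain with kernel `L` on sequences extends the past one step at a time.
  let L := condDistrib id seqShift M
  have hL : M ⊗ₘ L = M.map fun x => (seqShift x, x) := by
    have := compProd_map_condDistrib (mβ := inferInstance) (X := seqShift) (Y := id) (μ := M)
      aemeasurable_id
    rwa [hM] at this
  obtain ⟨Q, hQ, hQ0, hstep⟩ := exists_oneSided M L
  have hpair : ∀ n, Q.map (fun z => z n) = M →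
      Q.map (fun z => (z n, z (n + 1))) = M.map fun x => (seqShift x, x) := by
    intro n hn
    rw [← hL]
    have : IsProbabilityMeasure (Q.map fun z : ℕ → ℕ → ℝ => (z n, z (n + 1))) :=
      Measure.isProbabilityMeasure_map (by fun_prop)
    refine Measure.ext_prod fun {s t} hs ht => ?_
    have h := hstep n ((fun z => z n) ⁻¹' s) t (measurable_coordPast le_rfl hs) ht
    rw [Measure.compProd_apply_prod hs ht, Measure.map_apply (by fun_prop) (hs.prod ht)]
    rw [← hn, setLIntegral_map hs (L.measurable_coe ht) (measurable_pi_apply n)]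
    exact h
  have hgr : Measurable fun x : ℕ → ℝ => (seqShift x, x) := measurable_seqShift.prodMk measurable_id
  have hlaw : ∀ n, Q.map (fun z => z n) = M := by
    intro n
    induction n with
    | zero => exact hQ0
    | succ n ih =>
      have h := congrArg (fun ν => ν.map Prod.snd) (hpair n ih)
      rw [Measure.map_map measurable_snd (by fun_prop), Measure.map_map measurable_snd
        hgr] at h
      exact h.trans Measure.map_id
  have hshift : ∀ᵐ z ∂Q, ∀ n, seqShift (z (n + 1)) = z n := by
    rw [ae_all_iff]
    intro n
    have hS : MeasurableSet {p : (ℕ → ℝ) × (ℕ → ℝ) | seqShift p.2 = p.1} :=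
      measurableSet_eq_fun (measurable_seqShift.comp measurable_snd) measurable_fst
    have h : ∀ᵐ p ∂(Q.map fun z => (z n, z (n + 1))), seqShift p.2 = p.1 := by
      rw [hpair n (hlaw n), ae_map_iff hgr.aemeasurable hS]
      exact Eventually.of_forall fun _ => rfl
    rwa [ae_map_iff (by fun_prop) hS] at h
  -- The sequence `z k` represents the times from `-k` on, so time `n` has index `n + k` in it. The
  -- least admissible `k` is `(-n).toNat`; by `hshift` any larger one gives the same value almost
  -- surely.
  refine ⟨Q, fun n z => z (-n).toNat (n + (-n).toNat).toNat, hQ, fun n => by fun_prop, fun N => ?_⟩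
  have key : ∀ᵐ z ∂Q, (fun i : ℕ => z (-((i : ℤ) - N)).toNat
      (((i : ℤ) - N) + (-((i : ℤ) - N)).toNat).toNat) = z N := by
    filter_upwards [hshift] with z hz
    have hadd : ∀ j k i, z (k + j) (i + j) = z k i := by
      intro j
      induction j with
      | zero => intro k i; rfl
      | succ j ih =>
        intro k i
        rw [← ih k i, ← hz (k + j)]
        rfl
    funext i
    rcases le_total N i with h | h
    · have e1 : (-((i : ℤ) - N)).toNat = 0 := by lia
      have e2 : (((i : ℤ) - N) + ((0 : ℕ) : ℤ)).toNat = i - N := by lia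
      rw [e1, e2]
      have := hadd N 0 (i - N)
      rwa [zero_add, Nat.sub_add_cancel h, eq_comm] at this
    · have e1 : (-((i : ℤ) - N)).toNat = N - i := by lia
      have e2 : (((i : ℤ) - N) + ((N - i : ℕ) : ℤ)).toNat = 0 := by lia
      rw [e1, e2]
      have := hadd i (N - i) 0
      rwa [zero_add, Nat.sub_add_cancel h, eq_comm] at this
  rw [Measure.map_congr key, hlaw N]

variable {C : ℝ → ℝ → ℝ} {κ : Kernel ℝ ℝ} {Ω : Type*} [mΩ : MeasurableSpace Ω]
  {P : Measure Ω} [IsProbabilityMeasure P] {X : ℤ → Ω → ℝ} {M : Measure (ℕ → ℝ)}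

/-- The Markov property of a two-sided process all of whose restrictions to half-lines are one-sided
Markov chains. -/
lemma measure_inter_of_windows (hX : ∀ n, Measurable (X n))
    (hwin : ∀ N : ℕ, P.map (fun ω (i : ℕ) => X (i - N) ω) = M)
    (hstep : ∀ (n : ℕ) (A : Set (ℕ → ℝ)) (B : Set ℝ), MeasurableSet[coordPast ℝ n] A →
        MeasurableSet B → M (A ∩ (fun x => x (n + 1)) ⁻¹' B) = ∫⁻ x in A, κ (x n) B ∂M)
    (n : ℤ) {A : Set Ω} {B : Set ℝ} (hA : MeasurableSet[past X n] A) (hB : MeasurableSet B) :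
    P (A ∩ X (n + 1) ⁻¹' B) = ∫⁻ ω in A, κ (X n ω) B ∂P := by
  -- The path is read backwards from time `n`, so that it generates the past at `n`.
  let path : Ω → ℕ → ℝ := fun ω i => X (n - i) ω
  have hpath : Measurable path := measurable_pi_lambda _ fun i => hX _
  have heq : (P.restrict (X (n + 1) ⁻¹' B)).map path
      = (P.withDensity fun ω => κ (X n ω) B).map path := by
    refine ext_of_cylinder fun k D hD => ?_
    have hcyl := measurableSet_cylinder k hD
    rw [Measure.map_apply hpath hcyl, Measure.map_apply hpath hcyl,
      Measure.restrict_apply (hpath hcyl), withDensity_apply _ (hpath hcyl)]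
    -- The window starting at time `-N` contains the last `k` times up to `n`. Time `n` has index `K
    -- ≥ k` in it, so the subtractions `K - i` do not truncate.
    let N : ℕ := (k - n).toNat
    let K : ℕ := (n + N).toNat
    have hK : (K : ℤ) - N = n := by lia
    have hK1 : ((K + 1 : ℕ) : ℤ) - N = n + 1 := by lia
    have hkK : ∀ i < k, ((K - i : ℕ) : ℤ) - N = n - i := by lia
    have hwm : Measurable fun ω (i : ℕ) => X (i - N) ω := measurable_pi_lambda _ fun i => hX _
    have hDm : MeasurableSet[coordPast ℝ K] {x : ℕ → ℝ | ∀ i < k, x (K - i) ∈ D i} := by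
      have : {x : ℕ → ℝ | ∀ i < k, x (K - i) ∈ D i}
          = ⋂ i, ⋂ (_ : i < k), (fun x => x (K - i)) ⁻¹' D i := by
        ext; simp
      rw [this]
      exact MeasurableSet.iInter fun i => MeasurableSet.iInter fun _ =>
        measurable_coordPast (Nat.sub_le K i) (hD i)
    have hpre : path ⁻¹' {x | ∀ i < k, x i ∈ D i}
        = (fun ω (i : ℕ) => X (i - N) ω) ⁻¹' {x : ℕ → ℝ | ∀ i < k, x (K - i) ∈ D i} := by
      ext ω
      simp only [mem_preimage, mem_ofPred_eq, path]
      refine forall₂_congr fun i hi => ?_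
      rw [hkK i hi]
    have hS := coordPast_le K _ hDm
    have hκK : Measurable fun x : ℕ → ℝ => κ (x K) B :=
      (κ.measurable_coe hB).comp (measurable_pi_apply K)
    have h := hstep K _ B hDm hB
    rw [← hwin N, Measure.map_apply hwm (hS.inter (measurable_pi_apply (K + 1) hB)),
      setLIntegral_map hS hκK hwm] at h
    rw [hpre]
    rw [preimage_inter, ← preimage_comp] at h
    simp only [Function.comp_def, hK, hK1] at h
    exact h
  have hcomap : past X n ≤ MeasurableSpace.comap path inferInstance := by
    refine iSup₂_le fun j hj => ?_
    have : X j = (fun x => x (n - j).toNat) ∘ path := by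
      funext ω
      simp only [path, Function.comp_apply]
      congr 1
      lia
    rw [this, ← MeasurableSpace.comap_comp]
    exact MeasurableSpace.comap_mono (measurable_pi_apply _).comap_le
  obtain ⟨A', hA', rfl⟩ := hcomap A hA
  have := congrArg (fun ν => ν A') heq
  rwa [Measure.map_apply hpath hA', Measure.map_apply hpath hA',
    Measure.restrict_apply (hpath hA'), withDensity_apply _ (hpath hA')] at this

lemma isMarkovChainGeneratedBy_of_windows [IsMarkovKernel κ] (hC : IsCopula C) (hκ : IsKernelOf κ C)
    (hX : ∀ n, Measurable (X n))
    (hwin : ∀ N : ℕ, P.map (fun ω (i : ℕ) => X (i - N) ω) = M)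
    (hM : ∀ i : ℕ, M.map (fun x => x i) = unif)
    (hstep : ∀ (n : ℕ) (A : Set (ℕ → ℝ)) (B : Set ℝ), MeasurableSet[coordPast ℝ n] A →
        MeasurableSet B → M (A ∩ (fun x => x (n + 1)) ⁻¹' B) = ∫⁻ x in A, κ (x n) B ∂M) :
    IsMarkovChainGeneratedBy C P X := by
  have hstep' := fun n (A : Set Ω) B (hA : MeasurableSet[past X n] A) (hB : MeasurableSet B) =>
    measure_inter_of_windows (κ := κ) hX hwin hstep n hA hB
  have hunif : ∀ n, P.map (X n) = unif := by
    intro n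
    have hwm : Measurable fun ω (i : ℕ) => X (i - (-n).toNat) ω :=
      measurable_pi_lambda _ fun i => hX _
    rw [← hM (n + (-n).toNat).toNat, ← hwin (-n).toNat,
      Measure.map_map (measurable_pi_apply _) hwm]
    congr 1
    funext ω
    simp only [Function.comp_apply]
    congr 1
    lia
  refine ⟨hX, hunif, fun n x hx y hy => ?_, fun n B hB => ?_⟩
  · have h := hstep' n (X n ⁻¹' Iic x) (Iic y)
      (measurable_past X le_rfl measurableSet_Iic) measurableSet_Iic
    rw [← setLIntegral_map measurableSet_Iic (κ.measurable_coe measurableSet_Iic) (hX n),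
      hunif n, hκ x hx y hy] at h
    have hxy : {ω | X n ω ≤ x ∧ X (n + 1) ω ≤ y} = X n ⁻¹' Iic x ∩ X (n + 1) ⁻¹' Iic y := rfl
    rw [hxy, measureReal_def, h, ENNReal.toReal_ofReal (hC.mem_unit x hx y hy).1]
  -- Both conditional probabilities equal `κ (X n) B`: the same integral identity is tested on the
  -- past and on the smaller σ-algebra of `X n`.
  · refine ((condExp_indicator_ae_eq_iff (κ := κ) (past_le hX n) (measurable_past X le_rfl)
      (hX (n + 1)) hB).2 fun A hA => hstep' n A B hA hB).trans ?_
    exact ((condExp_indicator_ae_eq_iff (κ := κ) (hX n).comap_le (comap_measurable _)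
      (hX (n + 1)) hB).2 fun A hA => hstep' n A B (comap_le_past X le_rfl A hA) hB).symm

/-- Every copula generates a Markov chain, in every universe. -/
theorem IsCopula.exists_chain {C : ℝ → ℝ → ℝ} (hC : IsCopula C) :
    ∃ (Ω : Type u) (_ : MeasurableSpace Ω) (P : Measure Ω) (X : ℤ → Ω → ℝ),
      IsProbabilityMeasure P ∧ IsMarkovChainGeneratedBy C P X := by
  obtain ⟨M, hM, hM0, hstep⟩ := exists_oneSided unif hC.kernel
  have hstat : M.map seqShift = M := by
    refine map_seqShift_eq (κ := hC.kernel) ?_ hstep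
    rw [hM0]
    exact hC.isKernelOf_kernel.bind_unif hC
  have hMi : ∀ i : ℕ, M.map (fun x => x i) = unif := by
    intro i
    induction i with
    | zero => exact hM0
    | succ i ih =>
      rw [← ih]
      conv_rhs => rw [← hstat]
      rw [Measure.map_map (measurable_pi_apply i) measurable_seqShift]
      rfl
  obtain ⟨Q, X, hQ, hX, hwin⟩ := exists_twoSided hstat
  have hP : IsProbabilityMeasure (Q.map (ULift.up.{u} : (ℕ → ℕ → ℝ) → _)) :=
    Measure.isProbabilityMeasure_map measurable_up.aemeasurable
  refine ⟨ULift.{u} (ℕ → ℕ → ℝ), inferInstance, Q.map ULift.up, fun n ω => X n ω.down, hP, ?_⟩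
  have hX' : ∀ n, Measurable fun ω : ULift.{u} (ℕ → ℕ → ℝ) => X n ω.down := fun n =>
    (hX n).comp measurable_down
  refine isMarkovChainGeneratedBy_of_windows hC hC.isKernelOf_kernel hX' (fun N => ?_) hMi hstep
  rw [← hwin N, Measure.map_map (measurable_pi_lambda _ fun i => hX' _) measurable_up]
  rfl

end TwoSided

/-! ### Powers of a convex combination of contractions. -/

section Contraction

variable {V : Type*} [AddCommGroup V] [Module ℝ V] {k : ℕ} {T : Fin k → Module.End ℝ V}
  {a : Fin k → ℝ} {q : V → ℝ}

/-- Expand the power into words in the `T j`: the word `T i ^ m` has weight `a i ^ m`, and every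
other word is bounded by contraction. The induction peels off the letter acting first. -/
lemma energy_pow_sum_le (ha : ∀ j, 0 ≤ a j) (hsum : ∑ j, a j = 1)
    (hconv : ∀ x : Fin k → V, q (∑ j, a j • x j) ≤ ∑ j, a j * q (x j))
    (hT : ∀ j x, q (T j x) ≤ q x) (i : Fin k) (m : ℕ) (x : V) :
    q (((∑ j, a j • T j) ^ m) x) ≤ a i ^ m * q ((T i ^ m) x) + (1 - a i ^ m) * q x := by
  have hS : ∀ x, q ((∑ j, a j • T j) x) ≤ q x := fun x => by
    rw [LinearMap.sum_apply]
    simp only [LinearMap.smul_apply]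
    calc _ ≤ ∑ j, a j * q (T j x) := hconv _
      _ ≤ ∑ j, a j * q x := Finset.sum_le_sum fun j _ => mul_le_mul_of_nonneg_left (hT j x) (ha j)
      _ = q x := by rw [← Finset.sum_mul, hsum, one_mul]
  have hSm : ∀ (m : ℕ) x, q (((∑ j, a j • T j) ^ m) x) ≤ q x := by
    intro m
    induction m with
    | zero => intro x; simp
    | succ m ih =>
      intro x
      rw [pow_succ, Module.End.mul_apply]
      exact (ih _).trans (hS x)
  have hai : a i ≤ 1 := by
    rw [← hsum]; exact Finset.single_le_sum (fun j _ => ha j) (Finset.mem_univ i)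
  induction m generalizing x with
  | zero => simp
  | succ m ih =>
    have hpow : 0 ≤ 1 - a i ^ m := sub_nonneg.2 (pow_le_one₀ (ha i) hai)
    have h1 : ((∑ j, a j • T j) ^ (m + 1)) x
        = ∑ j, a j • ((∑ j, a j • T j) ^ m) (T j x) := by
      rw [pow_succ, Module.End.mul_apply, LinearMap.sum_apply, map_sum]
      simp only [LinearMap.smul_apply, map_smul]
    have h2 : ∑ j ∈ Finset.univ.erase i, a j = 1 - a i := by
      rw [← hsum, ← Finset.add_sum_erase _ _ (Finset.mem_univ i)]; ring
    calc q (((∑ j, a j • T j) ^ (m + 1)) x)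
        ≤ ∑ j, a j * q (((∑ j, a j • T j) ^ m) (T j x)) := by rw [h1]; exact hconv _
      _ = a i * q (((∑ j, a j • T j) ^ m) (T i x))
          + ∑ j ∈ Finset.univ.erase i, a j * q (((∑ j, a j • T j) ^ m) (T j x)) :=
          (Finset.add_sum_erase _ _ (Finset.mem_univ i)).symm
      _ ≤ a i * (a i ^ m * q ((T i ^ m) (T i x)) + (1 - a i ^ m) * q x)
          + ∑ j ∈ Finset.univ.erase i, a j * q x := by
          refine add_le_add (mul_le_mul_of_nonneg_left ((ih _).trans ?_) (ha i))
            (Finset.sum_le_sum fun j _ => mul_le_mul_of_nonneg_left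
              ((hSm m _).trans (hT j x)) (ha j))
          have := mul_le_mul_of_nonneg_left (hT i x) hpow
          linarith
      _ = _ := by
          rw [← Finset.sum_mul, h2, pow_succ (T i), Module.End.mul_apply, pow_succ (a i)]
          ring

/-- If one of the contractions in a convex combination has powers converging to zero uniformly on
an invariant set, then so does the combination. -/
lemma tendsto_pow_sum (ha : ∀ j, 0 ≤ a j) (hsum : ∑ j, a j = 1)
    (hconv : ∀ x : Fin k → V, q (∑ j, a j • x j) ≤ ∑ j, a j * q (x j))
    (hT : ∀ j x, q (T j x) ≤ q x) {D : Set V} (hD : ∀ x ∈ D, (∑ j, a j • T j) x ∈ D)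
    (hq : ∀ x ∈ D, q x ≤ 1) {i : Fin k} (hi : 0 < a i)
    (hmix : ∀ ε > 0, ∃ m : ℕ, ∀ x ∈ D, q ((T i ^ m) x) ≤ ε) {ε : ℝ} (hε : 0 < ε) :
    ∃ N : ℕ, ∀ n ≥ N, ∀ x ∈ D, q (((∑ j, a j • T j) ^ n) x) ≤ ε := by
  obtain ⟨m, hm⟩ := hmix (ε / 2) (half_pos hε)
  have hai : a i ≤ 1 := by
    rw [← hsum]; exact Finset.single_le_sum (fun j _ => ha j) (Finset.mem_univ i)
  set S : Module.End ℝ V := ∑ j, a j • T j with hSdef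
  set c := a i ^ m with hc
  have hc0 : 0 < c := pow_pos hi m
  have hc1 : c ≤ 1 := pow_le_one₀ (ha i) hai
  have hDn : ∀ (n : ℕ), ∀ x ∈ D, (S ^ n) x ∈ D := by
    intro n
    induction n with
    | zero => intro x hx; simpa using hx
    | succ n ih =>
      intro x hx
      rw [pow_succ, Module.End.mul_apply]
      exact ih _ (hD x hx)
  -- One block of length `m` turns a bound `u` into `c * (ε / 2) + (1 - c) * u`, with fixed point `ε
  -- / 2`; the starting bound is `ε / 2 + 1`.
  have hiter : ∀ (r : ℕ), ∀ x ∈ D, q ((S ^ (m * r)) x) ≤ ε / 2 + (1 - c) ^ r := by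
    intro r
    induction r with
    | zero =>
      intro x hx
      have := hq x hx
      simp only [mul_zero, pow_zero, Module.End.one_apply]
      linarith
    | succ r ih =>
      intro x hx
      have hy := hDn (m * r) x hx
      rw [mul_add, mul_one, add_comm, pow_add, Module.End.mul_apply]
      have h1 := energy_pow_sum_le ha hsum hconv hT i m ((S ^ (m * r)) x)
      have h2 := mul_le_mul_of_nonneg_left (hm _ hy) hc0.le
      have h3 := mul_le_mul_of_nonneg_left (ih x hx) (sub_nonneg.2 hc1)
      calc _ ≤ c * (ε / 2) + (1 - c) * (ε / 2 + (1 - c) ^ r) := h1.trans (add_le_add h2 h3)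
        _ = _ := by ring
  obtain ⟨r, hr⟩ := exists_pow_lt_of_lt_one (half_pos hε) (sub_lt_self 1 hc0)
  refine ⟨m * r, fun n hn x hx => ?_⟩
  -- The surplus `l` powers act first and stay inside `D`, so the block bound still applies.
  obtain ⟨l, rfl⟩ := Nat.exists_eq_add_of_le hn
  rw [pow_add, Module.End.mul_apply]
  have := hiter r _ (hDn l x hx)
  linarith

end Contraction

/-! ### The transition operator and its energy. -/

section Operator

/-- The space of bounded Borel functions on the line. -/
def bddMeas : Submodule ℝ (ℝ → ℝ) where
  carrier := {f | Measurable f ∧ ∃ c, ∀ x, |f x| ≤ c}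
  add_mem' := by
    rintro f g ⟨hf, c, hc⟩ ⟨hg, d, hd⟩
    exact ⟨hf.add hg, c + d, fun x => (abs_add_le _ _).trans (add_le_add (hc x) (hd x))⟩
  zero_mem' := ⟨measurable_const, 0, fun x => by simp⟩
  smul_mem' := by
    rintro r f ⟨hf, c, hc⟩
    refine ⟨hf.const_smul r, |r| * c, fun x => ?_⟩
    rw [Pi.smul_apply, smul_eq_mul, abs_mul]
    exact mul_le_mul_of_nonneg_left (hc x) (abs_nonneg r)

lemma integrable_bdd (f : bddMeas) (ν : Measure ℝ) [IsFiniteMeasure ν] :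
    Integrable (f : ℝ → ℝ) ν := by
  obtain ⟨hf, c, hc⟩ := f.2
  exact Integrable.of_bound hf.aestronglyMeasurable c (Eventually.of_forall hc)

lemma integrable_sq_bdd (f : bddMeas) (ν : Measure ℝ) [IsFiniteMeasure ν] :
    Integrable (fun x => (f : ℝ → ℝ) x ^ 2) ν := by
  obtain ⟨hf, c, hc⟩ := f.2
  refine Integrable.of_bound (hf.pow_const 2).aestronglyMeasurable (c ^ 2)
    (Eventually.of_forall fun x => ?_)
  rw [norm_pow, Real.norm_eq_abs]
  exact pow_le_pow_left₀ (abs_nonneg _) (hc x) 2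

lemma abs_integral_le_of_abs_le {α : Type*} [MeasurableSpace α] {ν : Measure α}
    [IsProbabilityMeasure ν] {f : α → ℝ} {c : ℝ} (h : ∀ x, |f x| ≤ c) : |∫ x, f x ∂ν| ≤ c := by
  have := norm_integral_le_of_norm_le_const (μ := ν) (f := f) (C := c) (Eventually.of_forall h)
  simpa using this

/-- The operator `f ↦ ∫ f dκ(x, ·)` on bounded Borel functions. -/
noncomputable def transOp (κ : Kernel ℝ ℝ) [IsMarkovKernel κ] : Module.End ℝ bddMeas where
  toFun f := ⟨fun x => ∫ y, (f : ℝ → ℝ) y ∂κ x,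
    (f.2.1.stronglyMeasurable.integral_kernel (κ := κ)).measurable,
    f.2.2.imp fun _ hc _ => abs_integral_le_of_abs_le hc⟩
  map_add' f g := by
    ext x
    exact integral_add (integrable_bdd f (κ x)) (integrable_bdd g (κ x))
  map_smul' r f := by
    ext x
    exact integral_const_mul r _

variable {κ : Kernel ℝ ℝ} [IsMarkovKernel κ]

lemma transOp_apply (f : bddMeas) (x : ℝ) :
    (transOp κ f : ℝ → ℝ) x = ∫ y, (f : ℝ → ℝ) y ∂κ x := rfl

lemma integral_bind_kernel (ν : Measure ℝ) [IsFiniteMeasure ν] (f : bddMeas) :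
    ∫ y, (f : ℝ → ℝ) y ∂(ν.bind κ) = ∫ x, (transOp κ f : ℝ → ℝ) x ∂ν :=
  Kernel.integral_comp (κ := Kernel.const Unit ν) (η := κ) (a := ()) (integrable_bdd f _)

/-- The squared `L²` norm with respect to the uniform distribution. -/
noncomputable def energy (f : bddMeas) : ℝ := ∫ x, (f : ℝ → ℝ) x ^ 2 ∂unif

lemma energy_sum_le {k : ℕ} {a : Fin k → ℝ} (ha : ∀ j, 0 ≤ a j) (hsum : ∑ j, a j = 1)
    (f : Fin k → bddMeas) : energy (∑ j, a j • f j) ≤ ∑ j, a j * energy (f j) := by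
  have h1 : ∑ j, a j * energy (f j)
      = ∫ x, ∑ j, a j * (f j : ℝ → ℝ) x ^ 2 ∂unif := by
    rw [integral_finsetSum _ fun j _ => (integrable_sq_bdd (f j) unif).const_mul (a j)]
    simp only [integral_const_mul, energy]
  rw [h1]
  refine integral_mono (integrable_sq_bdd (∑ j, a j • f j) unif)
    (integrable_finsetSum _ fun j _ => (integrable_sq_bdd (f j) unif).const_mul (a j)) fun x => ?_
  have h2 : ((∑ j, a j • f j : bddMeas) : ℝ → ℝ) x = ∑ j, a j • (f j : ℝ → ℝ) x := by
    simp [Finset.sum_apply]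
  simp only [h2]
  have := (even_two.convexOn_pow (𝕜 := ℝ)).map_sum_le (t := Finset.univ) (w := a)
    (p := fun j => (f j : ℝ → ℝ) x) (fun j _ => ha j) hsum (fun _ _ => mem_univ _)
  simpa using this

/-- Nonnegativity of the variance of `f` under `κ x`. -/
lemma sq_transOp_le (f : bddMeas) (x : ℝ) :
    (transOp κ f : ℝ → ℝ) x ^ 2 ≤ ∫ y, (f : ℝ → ℝ) y ^ 2 ∂κ x := by
  set c := (transOp κ f : ℝ → ℝ) x with hc
  have h0 : 0 ≤ ∫ y, ((f : ℝ → ℝ) y - c) ^ 2 ∂κ x := integral_nonneg fun y => sq_nonneg _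
  have h1 : ∫ y, ((f : ℝ → ℝ) y - c) ^ 2 ∂κ x
      = ∫ y, (f : ℝ → ℝ) y ^ 2 ∂κ x - 2 * c * c + c ^ 2 := by
    have : ∀ y, ((f : ℝ → ℝ) y - c) ^ 2
        = ((f : ℝ → ℝ) y ^ 2 - 2 * c * (f : ℝ → ℝ) y) + c ^ 2 := fun y => by ring
    simp only [this]
    rw [integral_add, integral_sub, integral_const_mul, integral_const, ← transOp_apply, ← hc]
    · simp
    · exact integrable_sq_bdd f _
    · exact (integrable_bdd f _).const_mul _
    · exact (integrable_sq_bdd f _).sub ((integrable_bdd f _).const_mul _)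
    · exact integrable_const _
  nlinarith

/-- Integrate the pointwise bound `sq_transOp_le` and use invariance for `f ^ 2`. -/
lemma energy_transOp_le (hinv : unif.bind κ = unif) (f : bddMeas) :
    energy (transOp κ f) ≤ energy f := by
  let g : bddMeas := ⟨fun x => (f : ℝ → ℝ) x ^ 2, f.2.1.pow_const 2, by
    obtain ⟨c, hc⟩ := f.2.2
    refine ⟨c ^ 2, fun x => ?_⟩
    rw [abs_pow]
    exact pow_le_pow_left₀ (abs_nonneg _) (hc x) 2⟩
  have h1 : energy f = ∫ x, (transOp κ g : ℝ → ℝ) x ∂unif := by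
    rw [← integral_bind_kernel, hinv]; rfl
  rw [h1]
  exact integral_mono (integrable_sq_bdd (transOp κ f) unif) (integrable_bdd (transOp κ g) unif)
    fun x => sq_transOp_le f x

/-- The centred functions bounded by one. -/
def centredBall : Set bddMeas :=
  {f | (∀ x, |(f : ℝ → ℝ) x| ≤ 1) ∧ ∫ x, (f : ℝ → ℝ) x ∂unif = 0}

lemma energy_le_one {f : bddMeas} (hf : f ∈ centredBall) : energy f ≤ 1 := by
  have : |energy f| ≤ 1 := abs_integral_le_of_abs_le fun x => by
    rw [abs_pow]
    exact pow_le_one₀ (abs_nonneg _) (hf.1 x)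
  exact (le_abs_self _).trans this

lemma transOp_mem_centredBall (hinv : unif.bind κ = unif) {f : bddMeas} (hf : f ∈ centredBall) :
    transOp κ f ∈ centredBall :=
  ⟨fun _ => abs_integral_le_of_abs_le hf.1, by rw [← integral_bind_kernel, hinv, hf.2]⟩

lemma transOp_pow_mem_centredBall (hinv : unif.bind κ = unif) (n : ℕ) {f : bddMeas}
    (hf : f ∈ centredBall) : (transOp κ ^ n) f ∈ centredBall := by
  induction n with
  | zero => simpa using hf
  | succ n ih =>
    rw [pow_succ', Module.End.mul_apply]
    exact transOp_mem_centredBall hinv ih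

end Operator

/-! ### Covariances of bounded functions and the mixing coefficient. -/

section Covariance

/-- The covariance with a function bounded by one is controlled by the covariance with events. -/
lemma exists_set_cov_le {Ω : Type*} {m₀ mΩ : MeasurableSpace Ω} {P : Measure Ω}
    [IsProbabilityMeasure P] (hm : m₀ ≤ mΩ) {ξ η : Ω → ℝ} (hξ : Integrable ξ P)
    (hη : Measurable[m₀] η) (hη1 : ∀ ω, |η ω| ≤ 1) :
    ∃ E, MeasurableSet[m₀] E ∧ ∫ ω, ξ ω * η ω ∂P - (∫ ω, ξ ω ∂P) * ∫ ω, η ω ∂P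
      ≤ 2 * (∫ ω in E, ξ ω ∂P - (∫ ω, ξ ω ∂P) * P.real E) := by
  set c := ∫ ω, ξ ω ∂P with hc
  let ζ : Ω → ℝ := fun ω => ξ ω - c
  have hζ : Integrable ζ P := hξ.sub (integrable_const c)
  have hζ0 : ∫ ω, ζ ω ∂P = 0 := by
    simp only [ζ]
    rw [integral_sub hξ (integrable_const c)]
    simp [hc]
  let h : Ω → ℝ := P[ζ | m₀]
  have hsm : StronglyMeasurable[m₀] h := stronglyMeasurable_condExp
  have hi : Integrable h P := integrable_condExp
  have hE : MeasurableSet[m₀] {ω | 0 ≤ h ω} := hsm.measurable measurableSet_Ici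
  have hηi : Integrable η P := Integrable.of_bound (hη.mono hm le_rfl).aestronglyMeasurable 1
    (Eventually.of_forall hη1)
  have hmul : ∀ {ρ : Ω → ℝ}, Integrable ρ P → Integrable (fun ω => η ω * ρ ω) P := fun hρ =>
    hρ.bdd_mul (hη.mono hm le_rfl).aestronglyMeasurable (Eventually.of_forall hη1)
  refine ⟨{ω | 0 ≤ h ω}, hE, ?_⟩
  have h1 : ∫ ω, ξ ω * η ω ∂P - c * ∫ ω, η ω ∂P = ∫ ω, η ω * ζ ω ∂P := by
    rw [← integral_const_mul, ← integral_sub]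
    · refine integral_congr_ae (Eventually.of_forall fun ω => ?_)
      simp only [ζ]; ring
    · simpa only [mul_comm] using hmul hξ
    · exact hηi.const_mul c
  have h2 : ∫ ω, η ω * ζ ω ∂P = ∫ ω, η ω * h ω ∂P := by
    rw [← integral_condExp hm (f := fun ω => η ω * ζ ω)]
    refine integral_congr_ae ?_
    exact condExp_mul_of_stronglyMeasurable_left hη.stronglyMeasurable (hmul hζ) hζ
  -- The integrand on the right is `|h|`. As `h` has mean zero, its integral is twice the integral
  -- of `h` over `{h ≥ 0}`, which gives the event and the factor `2`.
  have h3 : ∫ ω, η ω * h ω ∂P ≤ ∫ ω, (2 * {ω | 0 ≤ h ω}.indicator h ω - h ω) ∂P := by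
    refine integral_mono (hmul hi) (((hi.indicator (hm _ hE)).const_mul 2).sub hi) fun ω => ?_
    have habs := abs_le.1 (hη1 ω)
    by_cases hω : 0 ≤ h ω
    · simp only [indicator_of_mem (show ω ∈ {ω | 0 ≤ h ω} from hω)]
      nlinarith
    · simp only [indicator_of_notMem (show ω ∉ {ω | 0 ≤ h ω} from hω)]
      push Not at hω
      nlinarith
  have h4 : ∫ ω, (2 * {ω | 0 ≤ h ω}.indicator h ω - h ω) ∂P
      = 2 * ∫ ω in {ω | 0 ≤ h ω}, ζ ω ∂P := by
    rw [integral_sub ((hi.indicator (hm _ hE)).const_mul 2) hi, integral_const_mul,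
      integral_indicator (hm _ hE), integral_condExp hm, hζ0, setIntegral_condExp hm hζ hE,
      sub_zero]
  have h5 : ∫ ω in {ω | 0 ≤ h ω}, ζ ω ∂P
      = ∫ ω in {ω | 0 ≤ h ω}, ξ ω ∂P - c * P.real {ω | 0 ≤ h ω} := by
    simp only [ζ]
    rw [integral_sub hξ.integrableOn (integrable_const c), setIntegral_const, smul_eq_mul,
      mul_comm c]
  rw [h1, h2]
  exact h3.trans (by rw [h4, h5])

lemma abs_prob_le_alpha {Ω : Type*} {m₁ m₂ : MeasurableSpace Ω} [MeasurableSpace Ω]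
    {P : Measure Ω} [IsProbabilityMeasure P] {A B : Set Ω} (hA : MeasurableSet[m₁] A)
    (hB : MeasurableSet[m₂] B) : |P.real (A ∩ B) - P.real A * P.real B| ≤ alpha P m₁ m₂ := by
  refine le_csSup ⟨1, ?_⟩ ⟨A, B, hA, hB, rfl⟩
  rintro r ⟨A, B, -, -, rfl⟩
  have h1 := measureReal_nonneg (μ := P) (s := A ∩ B)
  have h2 := measureReal_le_one (μ := P) (s := A ∩ B)
  have h3 := mul_nonneg (measureReal_nonneg (μ := P) (s := A)) (measureReal_nonneg (μ := P) (s := B))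
  have h4 := mul_le_one₀ (measureReal_le_one (μ := P) (s := A))
    (measureReal_nonneg (μ := P) (s := B)) (measureReal_le_one (μ := P) (s := B))
  rw [abs_le]
  constructor <;> linarith

/-- Ibragimov's covariance inequality. -/
lemma cov_le_alpha {Ω : Type*} {m₁ m₂ mΩ : MeasurableSpace Ω} {P : Measure Ω}
    [IsProbabilityMeasure P] (hm₁ : m₁ ≤ mΩ) (hm₂ : m₂ ≤ mΩ) {ξ η : Ω → ℝ}
    (hξ : Measurable[m₁] ξ) (hξ1 : ∀ ω, |ξ ω| ≤ 1) (hη : Measurable[m₂] η)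
    (hη1 : ∀ ω, |η ω| ≤ 1) :
    ∫ ω, ξ ω * η ω ∂P - (∫ ω, ξ ω ∂P) * ∫ ω, η ω ∂P ≤ 4 * alpha P m₁ m₂ := by
  have hξi : Integrable ξ P := Integrable.of_bound (hξ.mono hm₁ le_rfl).aestronglyMeasurable 1
    (Eventually.of_forall hξ1)
  -- First `η` is replaced by an event, then `ξ`; each costs a factor `2`.
  obtain ⟨B, hB, h1⟩ := exists_set_cov_le hm₂ hξi hη hη1
  have hBi : Integrable (B.indicator fun _ => (1 : ℝ)) P := (integrable_const 1).indicator (hm₂ B hB)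
  obtain ⟨A, hA, h2⟩ := exists_set_cov_le hm₁ hBi hξ hξ1
  have e1 : ∫ ω, B.indicator (fun _ => (1 : ℝ)) ω ∂P = P.real B := by
    rw [integral_indicator (hm₂ B hB), setIntegral_const, smul_eq_mul, mul_one]
  have e2 : ∫ ω, B.indicator (fun _ => (1 : ℝ)) ω * ξ ω ∂P = ∫ ω in B, ξ ω ∂P := by
    rw [← integral_indicator (hm₂ B hB)]
    refine integral_congr_ae (Eventually.of_forall fun ω => ?_)
    by_cases hω : ω ∈ B <;> simp [hω]
  have e3 : ∫ ω in A, B.indicator (fun _ => (1 : ℝ)) ω ∂P = P.real (A ∩ B) := by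
    rw [setIntegral_indicator (hm₂ B hB), setIntegral_const, smul_eq_mul, mul_one]
  rw [e1, e2, e3] at h2
  have h3 := (le_abs_self _).trans (abs_prob_le_alpha (P := P) hA hB)
  linarith

end Covariance

/-! ### Mixing coefficients and decay of the operator powers. -/

section Chain

lemma future_le {Ω : Type*} [mΩ : MeasurableSpace Ω] {X : ℤ → Ω → ℝ} (hX : ∀ n, Measurable (X n)) (n : ℤ) : future X n ≤ mΩ :=
  iSup₂_le fun i _ => (hX i).comap_le

lemma future_le_comap {Ω : Type*} (X : ℤ → Ω → ℝ) (n : ℤ) :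
    future X n ≤ MeasurableSpace.comap (fun ω (i : ℕ) => X (n + i) ω) inferInstance := by
  refine iSup₂_le fun j hj => ?_
  have : X j = (fun x : ℕ → ℝ => x (j - n).toNat) ∘ fun ω (i : ℕ) => X (n + i) ω := by
    funext ω
    simp only [Function.comp_apply]
    congr 1
    lia
  rw [this, ← MeasurableSpace.comap_comp]
  exact MeasurableSpace.comap_mono (measurable_pi_apply _).comap_le

lemma IsMarkovChainGeneratedBy.map_eq_unif {C : ℝ → ℝ → ℝ} {Ω : Type*} [MeasurableSpace Ω]
    {P : Measure Ω} {X : ℤ → Ω → ℝ} (hX : IsMarkovChainGeneratedBy C P X) (n : ℤ) :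
    P.map (X n) = unif := hX.uniform n

lemma IsMarkovChainGeneratedBy.map_restrict_le {C : ℝ → ℝ → ℝ} {Ω : Type*}
    [MeasurableSpace Ω] {P : Measure Ω} {X : ℤ → Ω → ℝ} (hX : IsMarkovChainGeneratedBy C P X) (n : ℤ)
    (A : Set Ω) : (P.restrict A).map (X n) ≤ unif :=
  (Measure.map_mono Measure.restrict_le_self (hX.measurable n)).trans (hX.uniform n).le

variable {C : ℝ → ℝ → ℝ} {κ : Kernel ℝ ℝ} [IsMarkovKernel κ] {Ω : Type*} [mΩ : MeasurableSpace Ω]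
  {P : Measure Ω} [IsProbabilityMeasure P] {X : ℤ → Ω → ℝ}

lemma IsMarkovChainGeneratedBy.map_restrict_succ (hX : IsMarkovChainGeneratedBy C P X)
    (hC : IsCopula C) (hκ : IsKernelOf κ C) {n : ℤ} {A : Set Ω} (hA : MeasurableSet[past X n] A) :
    (P.restrict A).map (X (n + 1)) = ((P.restrict A).map (X n)).bind κ := by
  refine Measure.ext fun B hB => ?_
  rw [Measure.map_apply (hX.measurable _) hB, Measure.restrict_apply (hX.measurable _ hB),
    inter_comm, hX.measure_inter hC hκ n hA hB,
    Measure.bind_apply hB κ.measurable.aemeasurable,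
    lintegral_map (κ.measurable_coe hB) (hX.measurable n)]

lemma IsMarkovChainGeneratedBy.setIntegral_eq (hX : IsMarkovChainGeneratedBy C P X)
    (hC : IsCopula C) (hκ : IsKernelOf κ C) {A : Set Ω} (hA : MeasurableSet[past X 0] A)
    (n : ℕ) (f : bddMeas) :
    ∫ x, (f : ℝ → ℝ) x ∂((P.restrict A).map (X n))
      = ∫ x, ((transOp κ ^ n) f : ℝ → ℝ) x ∂((P.restrict A).map (X 0)) := by
  induction n generalizing f with
  | zero => rfl
  | succ n ih =>
    have hA' : MeasurableSet[past X n] A := past_mono X (Int.natCast_nonneg n) A hA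
    rw [Nat.cast_succ, hX.map_restrict_succ hC hκ hA', integral_bind_kernel, ih, pow_succ,
      Module.End.mul_apply]

/-- With `g = T ^ n f`, conditioning on the past gives `E[g (X 0) * f (X n)] = E[g (X 0) ^ 2]`. The
left side is a covariance since `f` is centred, so Ibragimov's inequality applies. -/
lemma IsMarkovChainGeneratedBy.energy_le_alpha (hX : IsMarkovChainGeneratedBy C P X)
    (hC : IsCopula C) (hκ : IsKernelOf κ C) (n : ℕ) {f : bddMeas} (hf : f ∈ centredBall) :
    energy ((transOp κ ^ n) f) ≤ 4 * alpha P (past X 0) (future X n) := by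
  set g := (transOp κ ^ n) f with hg
  have hgD : g ∈ centredBall := transOp_pow_mem_centredBall (hκ.bind_unif hC) n hf
  have hp := past_le hX.measurable 0
  have hξ : Measurable[past X 0] fun ω => (g : ℝ → ℝ) (X 0 ω) :=
    g.2.1.comp (measurable_past X le_rfl)
  have hη : Measurable[future X n] fun ω => (f : ℝ → ℝ) (X n ω) :=
    f.2.1.comp (Measurable.of_comap_le (le_iSup₂_of_le (n : ℤ) le_rfl le_rfl))
  have hcov := cov_le_alpha (P := P) hp (future_le hX.measurable n) hξ (fun ω => hgD.1 _) hη
    (fun ω => hf.1 _)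
  have hη0 : ∫ ω, (f : ℝ → ℝ) (X n ω) ∂P = 0 := by
    rw [← integral_map (hX.measurable n).aemeasurable f.2.1.aestronglyMeasurable, hX.uniform n]
    exact hf.2
  have hbd : ∀ (h : bddMeas) (i : ℤ), Integrable (fun ω => (h : ℝ → ℝ) (X i ω)) P := by
    intro h i
    exact (integrable_map_measure h.2.1.aestronglyMeasurable (hX.measurable i).aemeasurable).1
      (integrable_bdd h _)
  have hcond : (fun ω => (g : ℝ → ℝ) (X 0 ω)) =ᵐ[P] P[fun ω => (f : ℝ → ℝ) (X n ω) | past X 0] := by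
    refine ae_eq_condExp_of_forall_setIntegral_eq hp (hbd f n)
      (fun _ _ _ => (hbd g 0).integrableOn) (fun A hA _ => ?_) hξ.aestronglyMeasurable
    have := hX.setIntegral_eq hC hκ hA n f
    rw [integral_map (hX.measurable n).aemeasurable f.2.1.aestronglyMeasurable,
      integral_map (hX.measurable 0).aemeasurable (by exact g.2.1.aestronglyMeasurable)] at this
    exact this.symm
  have hprod : ∫ ω, (g : ℝ → ℝ) (X 0 ω) * (f : ℝ → ℝ) (X n ω) ∂P = energy g := by
    rw [← integral_condExp hp]
    have h1 := condExp_mul_of_stronglyMeasurable_left (m := past X 0) (μ := P)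
      hξ.stronglyMeasurable (g := fun ω => (f : ℝ → ℝ) (X n ω))
      ((hbd f n).bdd_mul (hξ.mono hp le_rfl).aestronglyMeasurable
        (Eventually.of_forall fun ω => hgD.1 _)) (hbd f n)
    rw [energy, ← hX.map_eq_unif 0, integral_map (hX.measurable 0).aemeasurable
      (by exact (g.2.1.pow_const 2).aestronglyMeasurable)]
    refine integral_congr_ae (h1.trans ?_)
    filter_upwards [hcond] with ω hω
    rw [Pi.mul_apply, ← hω, sq]
  rw [hη0, mul_zero, sub_zero, hprod] at hcov
  exact hcov

/-- Given the present, the past and the future are independent: the probability of a past event and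
a future event is an integral over the future event of a function of the present. -/
lemma IsMarkovChainGeneratedBy.measure_inter_future (hX : IsMarkovChainGeneratedBy C P X)
    (hC : IsCopula C) (hκ : IsKernelOf κ C) {n : ℤ} {A B : Set Ω}
    (hA : MeasurableSet[past X n] A) (hB : MeasurableSet[future X n] B) :
    P (A ∩ B) = ∫⁻ ω in B, ((P.restrict A).map (X n)).rnDeriv unif (X n ω) ∂P := by
  set ν := (P.restrict A).map (X n) with hν
  have hAm := past_le hX.measurable n A hA
  have hψ : Measurable (ν.rnDeriv unif) := Measure.measurable_rnDeriv _ _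
  have hac : ν ≪ unif := Measure.absolutelyContinuous_of_le (hX.map_restrict_le n A)
  have hseq := hX.isMarkovSeq hC hκ n
  have hf : Measurable[past X (n + (0 : ℕ))] (A.indicator (1 : Ω → ENNReal)) := by
    rw [Nat.cast_zero, add_zero]
    exact Measurable.indicator measurable_const hA
  have hf' : Measurable[past X (n + (0 : ℕ))] fun ω => ν.rnDeriv unif (X n ω) :=
    hψ.comp (measurable_past X (by simp))
  have hres : P.withDensity (A.indicator (1 : Ω → ENNReal)) = P.restrict A :=
    withDensity_indicator_one hAm
  have h0 : (P.withDensity (A.indicator (1 : Ω → ENNReal))).map (X (n + (0 : ℕ)))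
      = (P.withDensity fun ω => ν.rnDeriv unif (X n ω)).map (X (n + (0 : ℕ))) := by
    rw [Nat.cast_zero, add_zero, hres, ← hν]
    refine Measure.ext fun S hS => ?_
    rw [Measure.map_apply (μ := P.withDensity _) (hX.measurable n) hS, withDensity_apply _ (hX.measurable n hS),
      ← setLIntegral_map hS hψ (hX.measurable n), hX.uniform n, Measure.setLIntegral_rnDeriv hac]
  -- Restricting to `A` and weighting by the density at `X n` give the same law at time `n`, hence
  -- the same law of the path from `n` on.
  have hpath := hseq.map_path_eq hseq hf
    (by rw [lintegral_indicator_one hAm]; exact measure_ne_top _ _) hf' h0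
  obtain ⟨B', hB', rfl⟩ := future_le_comap X n B hB
  have h := congrArg (fun ρ => ρ B') hpath
  rw [Measure.map_apply hseq.measurable_path hB', Measure.map_apply hseq.measurable_path hB', hres,
    Measure.restrict_apply (hseq.measurable_path hB'),
    withDensity_apply _ (hseq.measurable_path hB')] at h
  rw [inter_comm]
  exact h

/-- Integrate `2 * ε * |t| ≤ ε ^ 2 + t ^ 2`. -/
lemma integral_abs_le_of_energy_le {f : bddMeas} {ε : ℝ} (hε : 0 < ε) (hf : energy f ≤ ε ^ 2) :
    ∫ x, |(f : ℝ → ℝ) x| ∂unif ≤ ε := by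
  have h1 : ∫ x, 2 * ε * |(f : ℝ → ℝ) x| ∂unif ≤ ∫ x, (ε ^ 2 + (f : ℝ → ℝ) x ^ 2) ∂unif := by
    refine integral_mono ((integrable_bdd f unif).abs.const_mul _)
      ((integrable_const _).add (integrable_sq_bdd f unif)) fun x => ?_
    simp only
    rw [← sq_abs ((f : ℝ → ℝ) x)]
    nlinarith [sq_nonneg (ε - |(f : ℝ → ℝ) x|)]
  rw [integral_const_mul, integral_add (integrable_const _) (integrable_sq_bdd f unif)] at h1
  change _ ≤ _ + energy f at h1
  simp only [integral_const, probReal_univ, smul_eq_mul, one_mul] at h1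
  nlinarith

/-- With `ψ` the density of the law of `X n` on `A` and `p` the probability of `A`, the dependence
is at most the L¹ norm of `ψ - p`. Testing against a sign function turns this norm into an integral
of `f (X n)` over `A`, which moves back to time `0` as one of `T ^ n f`. -/
lemma IsMarkovChainGeneratedBy.alpha_le (hX : IsMarkovChainGeneratedBy C P X)
    (hC : IsCopula C) (hκ : IsKernelOf κ C) (n : ℕ) {ε : ℝ} (hε : 0 < ε)
    (h : ∀ f ∈ centredBall, energy ((transOp κ ^ n) f) ≤ ε ^ 2) :
    alpha P (past X 0) (future X n) ≤ 2 * ε := by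
  refine Real.sSup_le ?_ (by positivity)
  rintro r ⟨A, B, hA, hB, rfl⟩
  have hXn := hX.measurable n
  have hBm := future_le hX.measurable n B hB
  set ν := (P.restrict A).map (X n) with hν
  set p := P.real A with hp
  have hac : ν ≪ unif := Measure.absolutelyContinuous_of_le (hX.map_restrict_le n A)
  let ψ : ℝ → ℝ := fun x => (ν.rnDeriv unif x).toReal
  have hψm : Measurable ψ := (Measure.measurable_rnDeriv _ _).ennreal_toReal
  have hψi : Integrable ψ unif := Measure.integrable_toReal_rnDeriv
  have hψXi : Integrable (fun ω => ψ (X n ω)) P := by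
    rw [← hX.map_eq_unif n] at hψi
    exact (integrable_map_measure hψm.aestronglyMeasurable hXn.aemeasurable).1 hψi
  have hfin : ∀ᵐ ω ∂P, ν.rnDeriv unif (X n ω) < ⊤ := by
    have : ∀ᵐ x ∂(P.map (X n)), ν.rnDeriv unif x < ⊤ := by
      rw [hX.uniform n]; exact Measure.rnDeriv_lt_top _ _
    exact ae_of_ae_map hXn.aemeasurable this
  have hAB : P.real (A ∩ B) = ∫ ω in B, ψ (X n ω) ∂P := by
    rw [measureReal_def, hX.measure_inter_future hC hκ
      (past_mono X (Int.natCast_nonneg n) A hA) hB]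
    exact (integral_toReal ((Measure.measurable_rnDeriv _ _).comp hXn).aemeasurable
      (ae_restrict_of_ae hfin)).symm
  have hbound : |P.real (A ∩ B) - p * P.real B| ≤ ∫ x, |ψ x - p| ∂unif := by
    have h1 : P.real (A ∩ B) - p * P.real B = ∫ ω in B, (ψ (X n ω) - p) ∂P := by
      rw [integral_sub hψXi.integrableOn (integrable_const p), setIntegral_const, smul_eq_mul,
        mul_comm p, hAB]
    have hi : Integrable (fun ω => |ψ (X n ω) - p|) P := (hψXi.sub (integrable_const p)).abs
    rw [h1]
    calc _ ≤ ∫ ω in B, |ψ (X n ω) - p| ∂P := abs_integral_le_integral_abs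
      _ ≤ ∫ ω, |ψ (X n ω) - p| ∂P :=
        setIntegral_le_integral hi (Eventually.of_forall fun _ => abs_nonneg _)
      _ = _ := by
        rw [← hX.map_eq_unif n, integral_map hXn.aemeasurable
          (by exact (hψm.sub measurable_const).abs.aestronglyMeasurable)]
  refine hbound.trans ?_
  classical
  let s : ℝ → ℝ := fun x => if p ≤ ψ x then 1 else -1
  have hsm : Measurable s :=
    Measurable.ite (measurableSet_le measurable_const hψm) measurable_const measurable_const
  have hs1 : ∀ x, |s x| ≤ 1 := fun x => by
    simp only [s]; split_ifs <;> simp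
  set c := ∫ x, s x ∂unif with hc
  have hc1 : |c| ≤ 1 := abs_integral_le_of_abs_le hs1
  have hsi : ∀ (ρ : Measure ℝ) [IsFiniteMeasure ρ], Integrable s ρ := fun ρ _ =>
    Integrable.of_bound hsm.aestronglyMeasurable 1 (Eventually.of_forall hs1)
  have hf1 : ∀ x, |(s x - c) / 2| ≤ 1 := fun x => by
    rw [abs_div, abs_two, div_le_one two_pos]
    exact (abs_sub _ _).trans (by linarith [hs1 x])
  -- Centring the sign function `s` can double its bound; the division by `2` restores it and
  -- accounts for the `2` in the conclusion.
  let f : bddMeas := ⟨fun x => (s x - c) / 2, (hsm.sub_const c).div_const 2, 1, hf1⟩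
  have hf : f ∈ centredBall := by
    refine ⟨hf1, ?_⟩
    show ∫ x, (s x - c) / 2 ∂unif = 0
    rw [integral_div, integral_sub (hsi unif) (integrable_const c)]
    simp [hc]
  have hνreal : ν.real univ = p := by
    rw [measureReal_def, hν, Measure.map_apply hXn MeasurableSet.univ]
    simp [hp, measureReal_def]
  have hsν : ∫ x, s x ∂ν = ∫ x, ψ x * s x ∂unif := by
    conv_lhs => rw [← Measure.withDensity_rnDeriv_eq _ _ hac]
    rw [integral_withDensity_eq_integral_toReal_smul (Measure.measurable_rnDeriv _ _)
      (Measure.rnDeriv_lt_top _ _)]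
    rfl
  have hfν : ∫ x, (f : ℝ → ℝ) x ∂ν = (∫ x, s x ∂ν - p * c) / 2 := by
    show ∫ x, (s x - c) / 2 ∂ν = _
    rw [integral_div, integral_sub (hsi ν) (integrable_const c), integral_const, hνreal,
      smul_eq_mul]
  have habs : ∫ x, |ψ x - p| ∂unif = 2 * ∫ x, (f : ℝ → ℝ) x ∂ν := by
    have hψs : Integrable (fun x => ψ x * s x) unif := by
      simpa only [mul_comm] using
        hψi.bdd_mul hsm.aestronglyMeasurable (Eventually.of_forall hs1)
    rw [hfν, hsν, hc, ← integral_const_mul p, ← integral_sub hψs ((hsi unif).const_mul p),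
      mul_div_cancel₀ _ (two_ne_zero' ℝ)]
    refine integral_congr_ae (Eventually.of_forall fun x => ?_)
    simp only [s]
    split_ifs with hx
    · rw [abs_of_nonneg (by linarith)]; ring
    · rw [abs_of_neg (by linarith)]; ring
  rw [habs, hX.setIntegral_eq hC hκ hA n f]
  set g := (transOp κ ^ n) f
  -- The law of `X 0` on `A` is dominated by the uniform law, so the bound does not degrade when `A`
  -- has small probability.
  have h2 : ∫ x, (g : ℝ → ℝ) x ∂((P.restrict A).map (X 0)) ≤ ∫ x, |(g : ℝ → ℝ) x| ∂unif :=
    (le_abs_self _).trans <| abs_integral_le_integral_abs.trans <|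
      integral_mono_measure (hX.map_restrict_le 0 A)
        (Eventually.of_forall fun _ => abs_nonneg _) (integrable_bdd g unif).abs
  have h3 := integral_abs_le_of_energy_le hε (h f hf)
  linarith

end Chain

/-! ### Mixtures of copulas, kernels and operators. -/

section Mixture

variable {k : ℕ} {a : Fin k → ℝ} {C : Fin k → ℝ → ℝ → ℝ}

lemma IsCopula.convexComb (hC : ∀ j, IsCopula (C j)) (ha : ∀ j, 0 ≤ a j) (hsum : ∑ j, a j = 1) :
    IsCopula fun x y => ∑ j, a j * C j x y where
  mem_unit x hx y hy := by
    refine ⟨Finset.sum_nonneg fun j _ => mul_nonneg (ha j) ((hC j).mem_unit x hx y hy).1, ?_⟩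
    rw [← hsum]
    exact Finset.sum_le_sum fun j _ => mul_le_of_le_one_right (ha j) ((hC j).mem_unit x hx y hy).2
  zero_left x hx := Finset.sum_eq_zero fun j _ => by rw [(hC j).zero_left x hx, mul_zero]
  zero_right x hx := Finset.sum_eq_zero fun j _ => by rw [(hC j).zero_right x hx, mul_zero]
  one_left x hx := by
    simp only [(hC _).one_left x hx]
    rw [← Finset.sum_mul, hsum, one_mul]
  one_right x hx := by
    simp only [(hC _).one_right x hx]
    rw [← Finset.sum_mul, hsum, one_mul]
  rect_nonneg p q r s h1 h2 h3 h4 h5 h6 := by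
    rw [← Finset.sum_add_distrib, ← Finset.sum_sub_distrib, ← Finset.sum_sub_distrib]
    refine Finset.sum_nonneg fun j _ => ?_
    have := mul_nonneg (ha j) ((hC j).rect_nonneg p q r s h1 h2 h3 h4 h5 h6)
    linarith

/-- The mixture of the kernels `κ j` with weights `a j`. -/
noncomputable def mixKernel (a : Fin k → ℝ) (κ : Fin k → Kernel ℝ ℝ) : Kernel ℝ ℝ where
  toFun x := ∑ j, ENNReal.ofReal (a j) • κ j x
  measurable' := by
    refine Measure.measurable_of_measurable_coe _ fun B hB => ?_
    simp only [Measure.finsetSum_apply, Measure.smul_apply, smul_eq_mul]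
    exact Finset.measurable_fun_sum _ fun j _ => ((κ j).measurable_coe hB).const_mul _

lemma mixKernel_apply (κ : Fin k → Kernel ℝ ℝ) (x : ℝ) :
    mixKernel a κ x = ∑ j, ENNReal.ofReal (a j) • κ j x := rfl

lemma mixKernel_apply_apply (κ : Fin k → Kernel ℝ ℝ) (x : ℝ) (B : Set ℝ) :
    mixKernel a κ x B = ∑ j, ENNReal.ofReal (a j) * κ j x B := by
  simp [mixKernel_apply, Measure.finsetSum_apply]

lemma isKernelOf_mixKernel (κ : Fin k → Kernel ℝ ℝ) (hC : ∀ j, IsCopula (C j))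
    (hκ : ∀ j, IsKernelOf (κ j) (C j)) (ha : ∀ j, 0 ≤ a j) : IsKernelOf (mixKernel a κ) fun x y => ∑ j, a j * C j x y := by
  intro x hx y hy
  simp only [mixKernel_apply_apply]
  rw [lintegral_finsetSum _ fun j _ => ((κ j).measurable_coe measurableSet_Iic).const_mul _,
    ENNReal.ofReal_sum_of_nonneg fun j _ => mul_nonneg (ha j) ((hC j).mem_unit x hx y hy).1]
  refine Finset.sum_congr rfl fun j _ => ?_
  rw [lintegral_const_mul _ ((κ j).measurable_coe measurableSet_Iic), hκ j x hx y hy,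
    ENNReal.ofReal_mul (ha j)]

variable (κ : Fin k → Kernel ℝ ℝ) [∀ j, IsMarkovKernel (κ j)]

lemma isMarkovKernel_mixKernel (ha : ∀ j, 0 ≤ a j) (hsum : ∑ j, a j = 1) :
    IsMarkovKernel (mixKernel a κ) := ⟨fun x => ⟨by
  rw [mixKernel_apply_apply]
  simp only [measure_univ, mul_one]
  rw [← ENNReal.ofReal_sum_of_nonneg fun j _ => ha j, hsum, ENNReal.ofReal_one]⟩⟩

lemma transOp_mixKernel [IsMarkovKernel (mixKernel a κ)] (ha : ∀ j, 0 ≤ a j) :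
    transOp (mixKernel a κ) = ∑ j, a j • transOp (κ j) := by
  ext f x
  rw [transOp_apply, mixKernel_apply, integral_finsetSum_measure fun j _ =>
    (integrable_bdd f (κ j x)).smul_measure ENNReal.ofReal_ne_top]
  simp only [integral_smul_measure, ENNReal.toReal_ofReal (ha _), LinearMap.sum_apply,
    LinearMap.smul_apply, ← transOp_apply]
  simp [Finset.sum_apply]

end Mixture

/-- If `C` generates `α`-mixing Markov chains, then the powers of its transition operator converge
to zero in `L²`, uniformly on the centred functions bounded by one. -/
lemma exists_energy_pow_le {C : ℝ → ℝ → ℝ} (hC : IsCopula C)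
    (hmix : GeneratesAlphaMixing.{u} C) {ε : ℝ} (hε : 0 < ε) :
    ∃ m : ℕ, ∀ f ∈ centredBall, energy ((transOp hC.kernel ^ m) f) ≤ ε := by
  -- The resulting operator bound no longer mentions probability spaces, so it can serve chains in
  -- another universe.
  obtain ⟨Ω, _, P, X, hP, hX⟩ := IsCopula.exists_chain.{u} hC
  have hlim : Tendsto (fun n : ℕ => alpha P (past X 0) (future X (n : ℤ))) atTop (𝓝 0) :=
    hmix Ω P X hX
  obtain ⟨m, hm⟩ := (hlim.eventually_lt_const (show 0 < ε / 4 by positivity)).exists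
  refine ⟨m, fun f hf => ?_⟩
  have := hX.energy_le_alpha hC hC.isKernelOf_kernel m hf
  linarith

end CopulaChain

theorem corollary2p1 (k : ℕ) (C : Fin k → ℝ → ℝ → ℝ) (a : Fin k → ℝ)
    (hC : ∀ j, CopulaChain.IsCopula (C j))
    (hmix : ∀ j, CopulaChain.GeneratesAlphaMixing.{u} (C j))
    (ha : ∀ j, 0 ≤ a j) (hsum : ∑ j, a j = 1) :
    CopulaChain.IsCopula (fun x y => ∑ j, a j * C j x y) ∧
      CopulaChain.GeneratesAlphaMixing.{v} (fun x y => ∑ j, a j * C j x y) := by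
  have hcop := CopulaChain.IsCopula.convexComb hC ha hsum
  refine ⟨hcop, fun Ω _ P _ X hX => ?_⟩
  obtain ⟨i, hi⟩ : ∃ i, 0 < a i := by
    by_contra! h
    have := Finset.sum_nonpos fun j (_ : j ∈ Finset.univ) => h j
    linarith
  -- The given chain may be analysed with any kernel of its copula; the mixture of kernels is chosen
  -- because its operator is the convex combination.
  have hκ := CopulaChain.isKernelOf_mixKernel (fun j => (hC j).kernel) hC
    (fun j => (hC j).isKernelOf_kernel) ha
  have := CopulaChain.isMarkovKernel_mixKernel (a := a) (fun j => (hC j).kernel) ha hsum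
  have hop := CopulaChain.transOp_mixKernel (a := a) (fun j => (hC j).kernel) ha
  refine tendsto_order.2 ⟨fun b hb => Eventually.of_forall fun n => hb.trans_le ?_,
    fun b hb => ?_⟩
  · exact Real.sSup_nonneg (by rintro r ⟨A, B, -, -, rfl⟩; exact abs_nonneg _)
  obtain ⟨N, hN⟩ := CopulaChain.tendsto_pow_sum (T := fun j => CopulaChain.transOp (hC j).kernel)
    (q := CopulaChain.energy) (D := CopulaChain.centredBall) ha hsum
    (CopulaChain.energy_sum_le ha hsum)
    (fun j => CopulaChain.energy_transOp_le ((hC j).isKernelOf_kernel.bind_unif (hC j)))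
    (fun f hf => hop ▸ CopulaChain.transOp_mem_centredBall (hκ.bind_unif hcop) hf)
    (fun f hf => CopulaChain.energy_le_one hf) hi
    (fun ε hε => CopulaChain.exists_energy_pow_le (hC i) (hmix i) hε)
    -- Energy at most `(b / 4) ^ 2` gives a mixing coefficient at most `2 * (b / 4) < b`.
    (show 0 < (b / 4) ^ 2 by positivity)
  filter_upwards [eventually_ge_atTop N] with n hn
  have := hX.alpha_le hcop hκ n (show 0 < b / 4 by positivity)
    (fun f hf => by rw [hop]; exact hN n hn f hf)
  linarith
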